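/- **Model.** Let $0\le M<N$ be integers, and let $f_1,\dots,f_N\ge 0$ with $\sum_j f_j=1$ be the request probabilities of the $N$ packets (not necessarily equal). Base stations (BSs) form a homogeneous Poisson point process of intensity $\lambda_b>0$ on $\mathbb R^2$. The transmit power is $P>0$, the path-loss exponent $\beta>2$, the bandwidth $B>0$, the slot duration $\tau>0$, the packet length $T>0$, and $\bar T=2^{T/(\tau B)}-1$. The fading is Rayleigh with unit mean power, so power gains are independent exponential variables with mean $1$. Every user caches exactly $M$ packets. The users are divided into $\binom NM$ subsets: a fraction $p_i$ of the users is in the $i$-th subset ($0\le p_i\le 1$, $\sum_i p_i=1$), and $q_{i,j}\in\{0,1\}$ says whether these users cache packet $j$ (so $\sum_j q_{i,j}=M$). Such a pair $(\mathbf P,\mathbf Q)=([p_i],[q_{i,j}])$ is a caching scheme. Put $q_j=\sum_i p_iq_{i,j}$. Independently of each other and of everything else, BSs transmit packet $j$ with probability $$\alpha_j=\frac{\sum_i p_i(1-q_{i,j})f_j}{\sum_k\sum_i p_i(1-q_{i,k})f_k}.$$ A typical user at the origin, in the $i$-th subset, is served by its nearest BS, at distance $R$. All BSs at distance more than $R$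 interfere, except that a BS at distance at most $R_b$ transmitting a packet cached by the user is cancelled. With noise power $\sigma^2$, $$\mathrm{SINR}=\frac{P\,h_0R^{-\beta}}{\sum_{k\ \text{residual interferer}}P\,h_k d_k^{-\beta}+\sigma^2},$$ where $d_k$ is the distance of BS $k$ and $h_0,h_k$ are the power gains. The packet loss rate (PLR) of packet $j$ in the $i$-th subset is $\mathcal P_{i,j}=(1-q_{i,j})\,\mathbb P\big(\tau B\log_2(1+\mathrm{SINR})<T\big)$, and the average PLR is $\mathcal P(R_b,\sigma^2)=\sum_i p_i\sum_j\mathcal P_{i,j}f_j$. **Program.** Let $\mathcal Z_1(x)=\frac{2\bar T}{\beta-2}\,{}_2F_1\big[1,1-\tfrac2\beta;2-\tfrac2\beta;-x\big]$, and consider $$\min_{\mathbf P,\mathbf Q}\ \ \sum_{i=1}^{\binom NM}p_i\,\frac{1-\sum_{j}q_{i,j}f_j}{1+\big(1-\sum_{j}f_jq_{i,j}\big)^{-1}\mathcal Z_1^{-1}(\bar T)}\qquad(\ast)$$ subject to $q_{i,j}\in\{0,1\}$, $0\le p_i\le1$, $\sum_jq_{i,j}=M$ for all $i$, $\sum_ip_i=1$,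 $\sum_iq_{i,j}p_i=\frac MN$ for all $j$, and $p_i\le p_j$ whenever $j<i$. (A summand whose numerator is $0$ is read as $0$.) **Proposition.** (1) For every caching scheme with $q_j=\frac MN$ for all $j$, the average PLR $\mathcal P(R_b,\sigma^2)$ converges, as $R_b\to\infty$ and $\sigma^2\to0^+$ jointly, to the value of the objective of $(\ast)$ at $(\mathbf P,\mathbf Q)$. (2) The program $(\ast)$ has an optimal solution, and there is one in which the rows of $\mathbf Q$ are pairwise distinct. (3) For every optimal solution of $(\ast)$, the limiting average PLR of this caching scheme equals the optimal value, and this value is the minimum of the limiting average PLRs over all caching schemes with $q_j=\frac MN$ for all $j$ whose subsets have pairwise distinct caches. -/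

import Mathlib

open MeasureTheory ProbabilityTheory Filter Topology
open scoped ENNReal NNReal

noncomputable section

namespace CacheNetwork

/-! ### Poisson point processes -/

/-- The number of points of the random sequence `X` that lie in `S`. -/
def pointCount {Ω E : Type*} (X : ℕ → Ω → E) (S : Set E) (ω : Ω) : ℝ≥0∞ :=
  ∑' k, S.indicator (fun _ => (1 : ℝ≥0∞)) (X k ω)

/-- The random points `X 0, X 1, …` (a measurable enumeration, in any order) form a Poisson point
process with intensity measure `Λ`: the number of points in a set of finite intensity has the
Poisson distribution, and the numbers of points in disjoint sets are independent. -/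
structure IsPoissonPointProcess {Ω E : Type*} [MeasurableSpace Ω] [MeasurableSpace E]
    (X : ℕ → Ω → E) (Λ : Measure E) (μ : Measure Ω) : Prop where
  measurable : ∀ k, Measurable (X k)
  count_law : ∀ S : Set E, MeasurableSet S → Λ S < ∞ →
    μ.map (pointCount X S) =
      (poissonMeasure (Λ S).toNNReal).map (fun n : ℕ => (n : ℝ≥0∞))
  count_indep : ∀ (n : ℕ) (S : Fin n → Set E), (∀ i, MeasurableSet (S i)) →
    (∀ i j, i ≠ j → Disjoint (S i) (S j)) →
    iIndepFun (fun i => pointCount X (S i)) μ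

/-! ### Caching schemes

The users are divided into `N.choose M` subsets; `p i` is the fraction of users in the `i`-th
subset, and `q i j = 1` if these users cache packet `j`, `q i j = 0` otherwise. -/

/-- `(p, q)` describes a division of the users into subsets, the users of each of which
cache exactly `M` of the `N` packets. -/
structure IsCachingScheme {N : ℕ} (M : ℕ)
    (p : Fin (N.choose M) → ℝ) (q : Fin (N.choose M) → Fin N → ℝ) : Prop where
  binary : ∀ i j, q i j = 0 ∨ q i j = 1
  density_mem : ∀ i, 0 ≤ p i ∧ p i ≤ 1
  cache_size : ∀ i, ∑ j, q i j = (M : ℝ)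
  density_sum : ∑ i, p i = 1

/-- The average caching probability of packet `j` over the whole network. -/
def cachingProbability {N M : ℕ} (p : Fin (N.choose M) → ℝ) (q : Fin (N.choose M) → Fin N → ℝ)
    (j : Fin N) : ℝ :=
  ∑ i, p i * q i j

/-- The fraction of base stations that transmit packet `j` in a slot, when packet `j` is requested
with probability `f j` and only packets outside the own cache are requested from base stations. -/
def transmitFraction {N M : ℕ} (f : Fin N → ℝ) (p : Fin (N.choose M) → ℝ)
    (q : Fin (N.choose M) → Fin N → ℝ) (j : Fin N) : ℝ :=
  (∑ i, p i * (1 - q i j) * f j) / ∑ k, ∑ i, p i * (1 - q i k) * f k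

/-- The law of the packet transmitted by a base station. -/
def transmitLaw {N : ℕ} (α : Fin N → ℝ) : Measure (Fin N) :=
  ∑ j, ENNReal.ofReal (α j) • Measure.dirac j

/-! ### The network seen by the typical user at the origin -/

/-- The parameters of the network. -/
structure Params where
  /-- intensity of the base stations -/
  bsDensity : ℝ
  /-- transmit power -/
  power : ℝ
  /-- path-loss exponent -/
  pathLoss : ℝ
  /-- bandwidth -/
  bandwidth : ℝ
  /-- slot duration -/
  slot : ℝ
  /-- packet length -/
  packetSize : ℝ

/-- The distance from the origin to the nearest base station (the serving one). -/
def servingDistance {Ω : Type*} (X : ℕ → Ω → EuclideanSpace ℝ (Fin 2)) (ω : Ω) : ℝ :=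
  ⨅ k, ‖X k ω‖

open Classical in
/-- Residual interference from the base stations that transmit a packet cached by the typical user
(`row j = 1` iff packet `j` is cached). Those at distance at most `Rb` are cancelled. The mark `m k`
of base station `k` is the packet it transmits and the power gain of its fading channel. -/
def cachedInterference (c : Params) {Ω : Type*} (X : ℕ → Ω → EuclideanSpace ℝ (Fin 2)) {N : ℕ}
    (row : Fin N → ℝ) (Rb : ℝ) (ω : Ω) (m : ℕ → Fin N × ℝ) : ℝ≥0∞ :=
  ∑' k, if row (m k).1 = 1 ∧ max (servingDistance X ω) Rb < ‖X k ω‖ then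
    ENNReal.ofReal (c.power * (m k).2 * ‖X k ω‖ ^ (-c.pathLoss)) else 0

open Classical in
/-- Interference from the base stations that transmit a packet not cached by the typical user. -/
def uncachedInterference (c : Params) {Ω : Type*} (X : ℕ → Ω → EuclideanSpace ℝ (Fin 2)) {N : ℕ}
    (row : Fin N → ℝ) (ω : Ω) (m : ℕ → Fin N × ℝ) : ℝ≥0∞ :=
  ∑' k, if row (m k).1 ≠ 1 ∧ servingDistance X ω < ‖X k ω‖ then
    ENNReal.ofReal (c.power * (m k).2 * ‖X k ω‖ ^ (-c.pathLoss)) else 0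

/-- The signal-to-interference-plus-noise ratio of the typical user; `h` is the power gain of the
fading channel from the serving base station, `noise` the power `σ²` of the noise. -/
def sinr (c : Params) {Ω : Type*} (X : ℕ → Ω → EuclideanSpace ℝ (Fin 2)) {N : ℕ}
    (row : Fin N → ℝ) (Rb noise : ℝ) (ω : Ω) (m : ℕ → Fin N × ℝ) (h : ℝ) : ℝ≥0∞ :=
  ENNReal.ofReal (c.power * h * servingDistance X ω ^ (-c.pathLoss)) /
    (cachedInterference c X row Rb ω m + uncachedInterference c X row ω m + ENNReal.ofReal noise)

/-- The joint law of the base station locations, of the marks of the base stations (independent;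
transmitted packet with law `α`, Rayleigh fading with unit mean power, so that the power gain is
exponential with mean one), and of the power gain of the serving channel. -/
def networkLaw {Ω : Type*} [MeasurableSpace Ω] (μ : Measure Ω) {N : ℕ} (α : Fin N → ℝ) :
    Measure (Ω × (ℕ → Fin N × ℝ) × ℝ) :=
  μ.prod ((Measure.infinitePi (fun _ : ℕ => (transmitLaw α).prod (expMeasure 1))).prod
    (expMeasure 1))

/-- The packet loss rate of an uncached packet for a user whose cache is given by `row`: the
probability that the packet cannot be transmitted completely within one slot. -/
def uncachedPLR (c : Params) {Ω : Type*} [MeasurableSpace Ω] (μ : Measure Ω)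
    (X : ℕ → Ω → EuclideanSpace ℝ (Fin 2)) {N : ℕ} (α row : Fin N → ℝ) (Rb noise : ℝ) : ℝ :=
  (networkLaw μ α).real
    {w | c.slot * c.bandwidth *
      Real.logb 2 (1 + (sinr c X row Rb noise w.1 w.2.1 w.2.2).toReal) < c.packetSize}

/-- The packet loss rate of packet `j` for the users of the `i`-th subset; cached packets are never
lost. -/
def packetLossRate (c : Params) {Ω : Type*} [MeasurableSpace Ω] (μ : Measure Ω)
    (X : ℕ → Ω → EuclideanSpace ℝ (Fin 2)) {N M : ℕ} (f : Fin N → ℝ)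
    (p : Fin (N.choose M) → ℝ) (q : Fin (N.choose M) → Fin N → ℝ) (Rb noise : ℝ)
    (i : Fin (N.choose M)) (j : Fin N) : ℝ :=
  (1 - q i j) * uncachedPLR c μ X (transmitFraction f p q) (q i) Rb noise

/-- The packet loss rate averaged over all users and requests. -/
def averagePLR (c : Params) {Ω : Type*} [MeasurableSpace Ω] (μ : Measure Ω)
    (X : ℕ → Ω → EuclideanSpace ℝ (Fin 2)) {N M : ℕ} (f : Fin N → ℝ)
    (p : Fin (N.choose M) → ℝ) (q : Fin (N.choose M) → Fin N → ℝ) (Rb noise : ℝ) : ℝ :=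
  ∑ i, p i * ∑ j, packetLossRate c μ X f p q Rb noise i j * f j

/-- The average packet loss rate tends to `L` as `Rb → ∞` and `σ² → 0⁺`. -/
def HasLimitingPLR (c : Params) {Ω : Type*} [MeasurableSpace Ω] (μ : Measure Ω)
    (X : ℕ → Ω → EuclideanSpace ℝ (Fin 2)) {N M : ℕ} (f : Fin N → ℝ)
    (p : Fin (N.choose M) → ℝ) (q : Fin (N.choose M) → Fin N → ℝ) (L : ℝ) : Prop :=
  Tendsto (fun s : ℝ × ℝ => averagePLR c μ X f p q s.1 s.2) (atTop ×ˢ 𝓝[>] 0) (𝓝 L)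

/-! ### The optimization problem -/

/-- The Gauss hypergeometric function `₂F₁(a, b; d; z)` for real `d > b > 0` and `z < 1`, by Euler's
integral (the power series only covers `|z| < 1`). -/
def gaussHypergeometric (a b d z : ℝ) : ℝ :=
  Real.Gamma d / (Real.Gamma b * Real.Gamma (d - b)) *
    ∫ t in (0 : ℝ)..1, t ^ (b - 1) * (1 - t) ^ (d - b - 1) * (1 - z * t) ^ (-a)

/-- The SINR threshold `2 ^ (T / (τ B)) - 1`. -/
def sinrThreshold (c : Params) : ℝ :=
  2 ^ (c.packetSize / (c.slot * c.bandwidth)) - 1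

/-- The function `𝒵₁`. -/
def Z₁ (c : Params) (x : ℝ) : ℝ :=
  2 * sinrThreshold c / (c.pathLoss - 2) *
    gaussHypergeometric 1 (1 - 2 / c.pathLoss) (2 - 2 / c.pathLoss) (-x)

/-- The objective of the program. -/
def objective (c : Params) {N M : ℕ} (f : Fin N → ℝ) (p : Fin (N.choose M) → ℝ)
    (q : Fin (N.choose M) → Fin N → ℝ) : ℝ :=
  ∑ i, p i * ((1 - ∑ j, q i j * f j) /
    (1 + (1 - ∑ j, f j * q i j)⁻¹ * (Z₁ c (sinrThreshold c))⁻¹))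

/-- The constraints of the program. -/
structure IsFeasible {N : ℕ} (M : ℕ)
    (p : Fin (N.choose M) → ℝ) (q : Fin (N.choose M) → Fin N → ℝ) : Prop where
  binary : ∀ i j, q i j = 0 ∨ q i j = 1
  density_mem : ∀ i, 0 ≤ p i ∧ p i ≤ 1
  cache_size : ∀ i, ∑ j, q i j = (M : ℝ)
  density_sum : ∑ i, p i = 1
  caching_probability : ∀ j, ∑ i, q i j * p i = (M : ℝ) / N
  sorted : ∀ i j, j < i → p i ≤ p j

/-- `(p, q)` is an optimal solution of the program. -/
def IsOptimal (c : Params) {N M : ℕ} (f : Fin N → ℝ) (p : Fin (N.choose M) → ℝ)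
    (q : Fin (N.choose M) → Fin N → ℝ) : Prop :=
  IsFeasible M p q ∧ ∀ p' q', IsFeasible M p' q' → objective c f p q ≤ objective c f p' q'

end CacheNetwork

end

/-! Rayleigh fading turns the success probability into a Laplace transform: given serving distance R
and interference plus noise D, it is exp(-θD) with θ = T̄ R^β / P (`expMeasure_success`). Averaging
over the independent marks gives a product over base stations (`lintegral_marks`). Let a be the
probability that a station transmits a packet outside the user's cache. As R_b → ∞ the stations
transmitting cached packets drop out, a station at distance d > R contributes 1 - a + a / (1 + T̄
(R/d)^β), and the noise factor tends to 1; dominated convergence passes to the limit.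

The areas λ_b π d² form a unit-rate Poisson process on [0, ∞), and the limiting product depends only
on their ratios to the first point m. Heuristically m is exponential with mean 1 and, given m = s,
the later points are again Poisson, so the mean is ∫ e^{-s} e^{-sκ} ds = 1/(1 + κ), where κ is the
integral over u > 1 of one minus the factor at ratio u. `lintegral_expNeg_ratioSum` proves this
without conditioning, by discretizing m. Euler's integral identifies κ with a 𝒵₁(T̄).

When all q_j = M/N, the transmit fractions equal f, so a is also the probability that a request
misses the cache. The contribution a (1 - 1/(1 + a𝒵₁)) = a / (1 + a⁻¹𝒵₁⁻¹) is a summand of the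
objective (`hasLimitingPLR`).

For the program, the objective depends only on the distribution that the scheme induces on the
caches. Merging equal caches reduces it to a linear function on a nonempty compact polytope of
weights (`uniformWeights`), which attains its minimum; permuting the subsets restores the ordering
constraint at no cost.

Infinite products of factors in [0, 1] are handled as `expNeg` of sums of `negLog` in [0, ∞]; an
infinite exponent also encodes the indicator of an event. -/

noncomputable section

namespace CacheNetwork

/-! ### The function `exp (-x)` on extended nonnegative reals -/

/-- `exp (-x)` for `x ∈ [0, ∞]`. -/
def expNeg (x : ℝ≥0∞) : ℝ≥0∞ := EReal.exp (-(x : EReal))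

@[simp] lemma expNeg_zero : expNeg 0 = 1 := by simp [expNeg]

@[simp] lemma expNeg_top : expNeg ∞ = 0 := by simp [expNeg]

lemma expNeg_ofReal {x : ℝ} (hx : 0 ≤ x) :
    expNeg (ENNReal.ofReal x) = ENNReal.ofReal (Real.exp (-x)) := by
  rw [expNeg, EReal.coe_ennreal_ofReal, max_eq_left hx, ← EReal.coe_neg, EReal.exp_coe]

lemma expNeg_add (x y : ℝ≥0∞) : expNeg (x + y) = expNeg x * expNeg y := by
  rw [expNeg, EReal.coe_ennreal_add, EReal.neg_add (by simp) (by simp), sub_eq_add_neg,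
    EReal.exp_add]
  rfl

lemma expNeg_sum {ι : Type*} (s : Finset ι) (g : ι → ℝ≥0∞) :
    expNeg (∑ i ∈ s, g i) = ∏ i ∈ s, expNeg (g i) := by
  classical
  induction s using Finset.induction_on with
  | empty => simp
  | insert a s ha ih => rw [Finset.sum_insert ha, Finset.prod_insert ha, expNeg_add, ih]

lemma continuous_expNeg : Continuous expNeg :=
  ENNReal.continuous_exp.comp (continuous_neg.comp continuous_coe_ennreal_ereal)

@[fun_prop] lemma measurable_expNeg : Measurable expNeg := continuous_expNeg.measurable

lemma antitone_expNeg : Antitone expNeg := fun x y h =>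
  EReal.exp_monotone (by simpa using h)

lemma expNeg_le_one (x : ℝ≥0∞) : expNeg x ≤ 1 := by
  simpa using antitone_expNeg (zero_le : 0 ≤ x)

lemma expNeg_ne_top (x : ℝ≥0∞) : expNeg x ≠ ∞ := ne_top_of_le_ne_top (by simp) (expNeg_le_one x)

lemma expNeg_mul_natCast (c : ℝ≥0∞) (n : ℕ) : expNeg (c * n) = expNeg c ^ n := by
  have := expNeg_sum (Finset.range n) (fun _ => c)
  simpa [mul_comm] using this

lemma one_sub_expNeg_le (x : ℝ≥0∞) : 1 - expNeg x ≤ x := by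
  by_cases hx : x = ∞
  · simp [hx]
  rw [← ENNReal.ofReal_toReal hx, expNeg_ofReal ENNReal.toReal_nonneg, ← ENNReal.ofReal_one,
    ← ENNReal.ofReal_sub _ (Real.exp_pos _).le]
  exact ENNReal.ofReal_le_ofReal (by linarith [Real.add_one_le_exp (-x.toReal)])

lemma tendsto_prod_expNeg (g : ℕ → ℝ≥0∞) :
    Tendsto (fun n => ∏ k ∈ Finset.range n, expNeg (g k)) atTop (𝓝 (expNeg (∑' k, g k))) := by
  simp_rw [← expNeg_sum]
  exact (continuous_expNeg.tendsto _).comp ENNReal.summable.hasSum.tendsto_sum_nat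

/-- The inverse of `expNeg` on `[0, 1]`. -/
def negLog (y : ℝ≥0∞) : ℝ≥0∞ := (-ENNReal.log y).toENNReal

lemma expNeg_negLog {y : ℝ≥0∞} (hy : y ≤ 1) : expNeg (negLog y) = y := by
  rw [expNeg, negLog, EReal.coe_toENNReal, neg_neg, ENNReal.exp_log]
  rw [EReal.le_neg, neg_zero]
  simpa using hy

lemma negLog_ofReal {y : ℝ} (hy : 0 < y) :
    negLog (ENNReal.ofReal y) = ENNReal.ofReal (-Real.log y) := by
  rw [negLog, ENNReal.log_ofReal_of_pos hy, ← EReal.coe_neg, EReal.toENNReal_of_ne_top (by simp),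
    EReal.toReal_coe]

@[fun_prop] lemma measurable_negLog : Measurable negLog :=
  measurable_ereal_toENNReal.comp (measurable_id.ennreal_log.neg)

/-! ### The Laplace functional of a Poisson point process -/

lemma tendsto_tsum_of_monotone {ι : Type*} [Countable ι] {g : ℕ → ι → ℝ≥0∞} {G : ι → ℝ≥0∞}
    (hmono : ∀ i, Monotone fun n => g n i)
    (hlim : ∀ i, Tendsto (fun n => g n i) atTop (𝓝 (G i))) :
    Tendsto (fun n => ∑' i, g n i) atTop (𝓝 (∑' i, G i)) := by
  let _ : MeasurableSpace ι := ⊤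
  simp_rw [← lintegral_count]
  exact lintegral_tendsto_of_tendsto_of_monotone (fun n => (measurable_of_countable _).aemeasurable)
    (ae_of_all _ hmono) (ae_of_all _ hlim)

/-- The value 0 is left out because its level set may have infinite intensity, where `count_law`
says nothing. -/
lemma tsum_simpleFunc_eq {Ω E : Type*} [MeasurableSpace E] (X : ℕ → Ω → E)
    (F : SimpleFunc E ℝ≥0∞) (ω : Ω) :
    ∑' k, F (X k ω) =
      ∑ c ∈ F.range.filter (· ≠ 0), c * pointCount X (F ⁻¹' {c}) ω := by
  simp_rw [pointCount, ← ENNReal.tsum_mul_left]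
  rw [← Summable.tsum_finsetSum fun _ _ => ENNReal.summable]
  refine tsum_congr fun k => ?_
  by_cases h0 : F (X k ω) = 0
  · rw [h0, Finset.sum_eq_zero]
    intro c hc
    have : c ≠ 0 := (Finset.mem_filter.1 hc).2
    simp [h0, this.symm]
  · rw [Finset.sum_eq_single (F (X k ω))]
    · simp
    · intro c _ hc
      simp [hc.symm]
    · intro h
      exact absurd (Finset.mem_filter.2 ⟨SimpleFunc.mem_range_self F _, h0⟩) h

section Laplace

variable {Ω E : Type*} [MeasurableSpace Ω] [MeasurableSpace E]

lemma measurable_pointCount {X : ℕ → Ω → E} (hX : ∀ k, Measurable (X k)) {S : Set E}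
    (hS : MeasurableSet S) : Measurable (pointCount X S) :=
  Measurable.tsum fun k =>
    (measurable_const.indicator hS).comp (hX k)

/-- The generating function of the Poisson law, from the exponential series in y r. -/
lemma lintegral_poissonMeasure_pow (r : ℝ≥0) {y : ℝ≥0∞} (hy : y ≤ 1) :
    ∫⁻ n : ℕ, y ^ n ∂(poissonMeasure r) = expNeg ((1 - y) * r) := by
  obtain ⟨z, rfl⟩ : ∃ z : ℝ≥0, y = z := ⟨y.toNNReal, by
    rw [ENNReal.coe_toNNReal (ne_top_of_le_ne_top (by simp) hy)]⟩
  have hz : (z : ℝ) ≤ 1 := by exact_mod_cast hy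
  have h1 : (1 - (z : ℝ≥0∞)) * r = ENNReal.ofReal ((1 - (z : ℝ)) * r) := by
    rw [ENNReal.ofReal_mul (by linarith), ENNReal.ofReal_sub _ z.coe_nonneg]
    simp
  rw [h1, expNeg_ofReal (mul_nonneg (by linarith) r.coe_nonneg), lintegral_countable']
  have h2 : ∀ n : ℕ, (z : ℝ≥0∞) ^ n * poissonMeasure r {n} =
      ENNReal.ofReal (Real.exp (-r) * ((z * r : ℝ) ^ n / n.factorial)) := by
    intro n
    rw [poissonMeasure_singleton, ← ENNReal.ofReal_coe_nnreal, ← ENNReal.ofReal_pow z.coe_nonneg,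
      ← ENNReal.ofReal_mul (by positivity)]
    congr 1
    rw [mul_pow]; ring
  simp_rw [h2]
  have h3 : HasSum (fun n : ℕ => Real.exp (-r) * ((z * r : ℝ) ^ n / n.factorial))
      (Real.exp (-r) * Real.exp (z * r)) := by
    have := NormedSpace.expSeries_div_hasSum_exp (z * r : ℝ)
    rw [← Real.exp_eq_exp_ℝ] at this
    exact this.mul_left _
  rw [← ENNReal.ofReal_tsum_of_nonneg (fun n => by positivity) h3.summable, h3.tsum_eq,
    ← Real.exp_add]
  congr 2; ring

lemma IsPoissonPointProcess.lintegral_expNeg_pointCount {X : ℕ → Ω → E} {Λ : Measure E}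
    {μ : Measure Ω} (hX : IsPoissonPointProcess X Λ μ) {S : Set E} (hS : MeasurableSet S)
    (hΛ : Λ S < ∞) (c : ℝ≥0∞) :
    ∫⁻ ω, expNeg (c * pointCount X S ω) ∂μ = expNeg ((1 - expNeg c) * Λ S) := by
  have hm : Measurable fun x : ℝ≥0∞ => expNeg (c * x) :=
    measurable_expNeg.comp (measurable_const_mul c)
  rw [← lintegral_map hm (measurable_pointCount hX.measurable hS), hX.count_law S hS hΛ,
    lintegral_map hm (by fun_prop)]
  simp_rw [expNeg_mul_natCast]
  rw [lintegral_poissonMeasure_pow _ (expNeg_le_one c), ENNReal.coe_toNNReal hΛ.ne]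

/-- Distinct level sets are disjoint, so their counts are independent and the expectation splits
into Poisson generating functions. -/
lemma IsPoissonPointProcess.laplace_simpleFunc {X : ℕ → Ω → E} {Λ : Measure E}
    {μ : Measure Ω} (hX : IsPoissonPointProcess X Λ μ) (F : SimpleFunc E ℝ≥0∞)
    (hF : ∀ c ≠ 0, Λ (F ⁻¹' {c}) < ∞) :
    ∫⁻ ω, expNeg (∑' k, F (X k ω)) ∂μ = expNeg (∫⁻ x, (1 - expNeg (F x)) ∂Λ) := by
  classical
  set s := F.range.filter (· ≠ 0) with hs
  -- `count_indep` speaks of families over `Fin n`, so the nonzero values are enumerated; `hsum`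
  -- translates the products back.
  have hind : iIndepFun (fun i : Fin s.card =>
      pointCount X (F ⁻¹' {((s.equivFin.symm i : s) : ℝ≥0∞)})) μ := by
    refine hX.count_indep _ _ (fun i => F.measurableSet_preimage _) fun i j hij => ?_
    refine Disjoint.preimage _ (Set.disjoint_singleton.2 fun h => hij ?_)
    exact s.equivFin.symm.injective (Subtype.ext h)
  have hind' := hind.comp (fun i x => expNeg (((s.equivFin.symm i : s) : ℝ≥0∞) * x))
    (fun i => measurable_expNeg.comp (measurable_const_mul _))
  have h1 := lintegral_prod_eq_prod_lintegral_of_indepFun Finset.univ _ hind' (fun i =>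
    (measurable_expNeg.comp (measurable_const_mul _)).comp
      (measurable_pointCount hX.measurable (F.measurableSet_preimage _)))
  have hsum : ∀ g : ℝ≥0∞ → ℝ≥0∞,
      ∏ i : Fin s.card, g ((s.equivFin.symm i : s) : ℝ≥0∞) = ∏ c ∈ s, g c := fun g => by
    rw [Equiv.prod_comp s.equivFin.symm (fun c : s => g c), Finset.prod_coe_sort s g]
  have h2 : ∀ ω, expNeg (∑' k, F (X k ω)) =
      ∏ i : Fin s.card, expNeg (((s.equivFin.symm i : s) : ℝ≥0∞) *
        pointCount X (F ⁻¹' {((s.equivFin.symm i : s) : ℝ≥0∞)}) ω) := fun ω => by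
    rw [tsum_simpleFunc_eq, expNeg_sum]
    exact (hsum fun c => expNeg (c * pointCount X (F ⁻¹' {c}) ω)).symm
  simp_rw [h2]
  refine h1.trans ?_
  simp only [Function.comp_apply]
  rw [hsum fun c => ∫⁻ ω, expNeg (c * pointCount X (F ⁻¹' {c}) ω) ∂μ]
  have h3 : ∀ c ∈ s, ∫⁻ ω, expNeg (c * pointCount X (F ⁻¹' {c}) ω) ∂μ =
      expNeg ((1 - expNeg c) * Λ (F ⁻¹' {c})) := fun c hc =>
    hX.lintegral_expNeg_pointCount (F.measurableSet_preimage _)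
      (hF c (Finset.mem_filter.1 hc).2) c
  rw [Finset.prod_congr rfl h3, ← expNeg_sum]
  congr 1
  have h4 : ∫⁻ x, (1 - expNeg (F x)) ∂Λ = ∫⁻ x, (F.map fun c => 1 - expNeg c) x ∂Λ := rfl
  rw [h4, SimpleFunc.lintegral_eq_lintegral, SimpleFunc.map_lintegral, hs, Finset.sum_filter]
  refine Finset.sum_congr rfl fun c _ => ?_
  by_cases hc : c = 0 <;> simp [hc]

/-- The Laplace functional of a Poisson point process. -/
theorem IsPoissonPointProcess.laplace {X : ℕ → Ω → E} {Λ : Measure E} [SigmaFinite Λ]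
    {μ : Measure Ω} [IsFiniteMeasure μ] (hX : IsPoissonPointProcess X Λ μ) {F : E → ℝ≥0∞}
    (hF : Measurable F) :
    ∫⁻ ω, expNeg (∑' k, F (X k ω)) ∂μ = expNeg (∫⁻ x, (1 - expNeg (F x)) ∂Λ) := by
  -- Simple approximations cut off to sets of finite measure: still increasing to `F`, but now every
  -- nonzero level set has finite intensity.
  let f : ℕ → SimpleFunc E ℝ≥0∞ := fun n =>
    (SimpleFunc.eapprox F n).restrict (spanningSets Λ n)
  have hf : ∀ n x, f n x = (spanningSets Λ n).indicator (SimpleFunc.eapprox F n) x := fun n x =>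
    SimpleFunc.restrict_apply _ (measurableSet_spanningSets Λ n) x
  have hmono : ∀ x, Monotone fun n => f n x := fun x n m hnm => by
    simp only [hf]
    refine (Set.indicator_le_indicator_of_subset (monotone_spanningSets Λ hnm)
      (fun _ => zero_le) x).trans ?_
    exact Set.indicator_le_indicator (SimpleFunc.monotone_eapprox F hnm x)
  have hlim : ∀ x, Tendsto (fun n => f n x) atTop (𝓝 (F x)) := fun x => by
    refine (SimpleFunc.tendsto_eapprox hF x).congr' ?_
    filter_upwards [eventually_ge_atTop (spanningSetsIndex Λ x)] with n hn
    rw [hf, Set.indicator_of_mem]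
    exact monotone_spanningSets Λ hn (mem_spanningSetsIndex Λ x)
  have hfin : ∀ n, ∀ c ≠ 0, Λ (f n ⁻¹' {c}) < ∞ := fun n c hc => by
    refine (measure_mono fun x hx => ?_).trans_lt (measure_spanningSets_lt_top Λ n)
    by_contra hxs
    have : f n x = 0 := by rw [hf, Set.indicator_of_notMem hxs]
    exact hc (by rw [← this]; exact hx.symm)
  have hL : Tendsto (fun n => ∫⁻ ω, expNeg (∑' k, f n (X k ω)) ∂μ) atTop
      (𝓝 (∫⁻ ω, expNeg (∑' k, F (X k ω)) ∂μ)) := by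
    refine tendsto_lintegral_of_dominated_convergence (fun _ => 1) (fun n => ?_)
      (fun n => ae_of_all _ fun ω => expNeg_le_one _) (by simp) (ae_of_all _ fun ω => ?_)
    · exact measurable_expNeg.comp
        (Measurable.tsum fun k => (f n).measurable.comp (hX.measurable k))
    · exact (continuous_expNeg.tendsto _).comp
        (tendsto_tsum_of_monotone (fun k => hmono _) fun k => hlim _)
  have hR : Tendsto (fun n => expNeg (∫⁻ x, (1 - expNeg (f n x)) ∂Λ)) atTop
      (𝓝 (expNeg (∫⁻ x, (1 - expNeg (F x)) ∂Λ))) := by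
    refine (continuous_expNeg.tendsto _).comp ?_
    refine lintegral_tendsto_of_tendsto_of_monotone (fun n => ?_) (ae_of_all _ fun x n m hnm => ?_)
      (ae_of_all _ fun x => ?_)
    · exact (measurable_const.sub (measurable_expNeg.comp (f n).measurable)).aemeasurable
    · exact tsub_le_tsub_left (antitone_expNeg (hmono x hnm)) 1
    · exact ENNReal.Tendsto.sub tendsto_const_nhds
        ((continuous_expNeg.tendsto _).comp (hlim x)) (by simp)
  simp_rw [fun n => hX.laplace_simpleFunc (f n) (hfin n)] at hL
  exact tendsto_nhds_unique hL hR

end Laplace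

/-! ### The squared distances of a planar Poisson process -/

section Map

variable {Ω E E' : Type*} [MeasurableSpace Ω] [MeasurableSpace E] [MeasurableSpace E']

lemma IsPoissonPointProcess.map {X : ℕ → Ω → E} {Λ : Measure E} {μ : Measure Ω}
    (hX : IsPoissonPointProcess X Λ μ) {g : E → E'} (hg : Measurable g) :
    IsPoissonPointProcess (fun k ω => g (X k ω)) (Λ.map g) μ where
  measurable k := hg.comp (hX.measurable k)
  count_law S hS hΛ := by
    rw [Measure.map_apply hg hS] at hΛ ⊢
    exact hX.count_law _ (hg hS) hΛ
  count_indep n S hS hd := hX.count_indep n (fun i => g ⁻¹' S i) (fun i => hg (hS i))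
    fun i j hij => (hd i j hij).preimage g

/-- A nonnegative function with finite integral has a finite sum over a Poisson process. -/
lemma IsPoissonPointProcess.ae_tsum_lt_top {X : ℕ → Ω → E} {Λ : Measure E} [SigmaFinite Λ]
    {μ : Measure Ω} [IsProbabilityMeasure μ] (hX : IsPoissonPointProcess X Λ μ) {F : E → ℝ≥0∞}
    (hF : Measurable F) (hint : ∫⁻ x, F x ∂Λ ≠ ∞) : ∀ᵐ ω ∂μ, ∑' k, F (X k ω) < ∞ := by
  have hms : Measurable fun ω => ∑' k, F (X k ω) :=
    Measurable.tsum fun k => hF.comp (hX.measurable k)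
  have hS : MeasurableSet {ω | ∑' k, F (X k ω) < ∞} := measurableSet_lt hms measurable_const
  -- With S the sum and c = 1/(n+1): exp(-c ∫F) ≤ E exp(-cS) ≤ P(S < ∞), because exp(-cS) vanishes
  -- where S = ∞. Letting c → 0 gives P(S < ∞) = 1.
  have hbound : ∀ n : ℕ, expNeg ((n + 1 : ℝ≥0∞)⁻¹ * ∫⁻ x, F x ∂Λ) ≤
      μ {ω | ∑' k, F (X k ω) < ∞} := by
    intro n
    have hc0 : (n + 1 : ℝ≥0∞)⁻¹ ≠ 0 := by simp
    calc expNeg ((n + 1 : ℝ≥0∞)⁻¹ * ∫⁻ x, F x ∂Λ)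
        ≤ expNeg (∫⁻ x, (1 - expNeg ((n + 1 : ℝ≥0∞)⁻¹ * F x)) ∂Λ) := by
          refine antitone_expNeg ?_
          rw [← lintegral_const_mul _ hF]
          exact lintegral_mono fun x => one_sub_expNeg_le _
      _ = ∫⁻ ω, expNeg (∑' k, (n + 1 : ℝ≥0∞)⁻¹ * F (X k ω)) ∂μ :=
          (hX.laplace (hF.const_mul _)).symm
      _ ≤ ∫⁻ ω, {ω | ∑' k, F (X k ω) < ∞}.indicator 1 ω ∂μ := by
          refine lintegral_mono fun ω => ?_
          by_cases h : ∑' k, F (X k ω) < ∞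
          · rw [Set.indicator_of_mem (show ω ∈ {ω | ∑' k, F (X k ω) < ∞} from h)]
            exact expNeg_le_one _
          · rw [Set.indicator_of_notMem (show ω ∉ {ω | ∑' k, F (X k ω) < ∞} from h),
              ENNReal.tsum_mul_left, not_lt_top_iff.1 h,
              ENNReal.mul_top hc0, expNeg_top]
      _ = μ {ω | ∑' k, F (X k ω) < ∞} := lintegral_indicator_one hS
  have hlim : Tendsto (fun n : ℕ => expNeg ((n + 1 : ℝ≥0∞)⁻¹ * ∫⁻ x, F x ∂Λ)) atTop (𝓝 1) := by
    rw [← expNeg_zero]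
    refine (continuous_expNeg.tendsto _).comp ?_
    have h1 : Tendsto (fun n : ℕ => ((n + 1 : ℕ) : ℝ≥0∞)⁻¹) atTop (𝓝 0) :=
      ENNReal.tendsto_inv_nat_nhds_zero.comp (tendsto_add_atTop_nat 1)
    have := ENNReal.Tendsto.mul_const h1 (Or.inr hint)
    simpa using this
  have h1 : (1 : ℝ≥0∞) ≤ μ {ω | ∑' k, F (X k ω) < ∞} :=
    le_of_tendsto' hlim hbound
  rw [ae_iff_prob_eq_one (measurableSet_setOfPred.1 hS)]
  exact le_antisymm prob_le_one h1

end Map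

/-- The preimage of (-∞, c) is a disc whose area times b is c for c ≥ 0. In this coordinate the
planar process has unit rate on the half line. -/
lemma map_area_volume {b : ℝ} (hb : 0 < b) :
    (ENNReal.ofReal b • (volume : Measure (EuclideanSpace ℝ (Fin 2)))).map
      (fun x => b * Real.pi * ‖x‖ ^ 2) = volume.restrict (Set.Ici 0) := by
  have hbp : 0 < b * Real.pi := mul_pos hb Real.pi_pos
  have hm : Measurable fun x : EuclideanSpace ℝ (Fin 2) => b * Real.pi * ‖x‖ ^ 2 := by fun_prop
  have hIio : ∀ c : ℝ, (ENNReal.ofReal b • (volume : Measure (EuclideanSpace ℝ (Fin 2)))).map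
      (fun x => b * Real.pi * ‖x‖ ^ 2) (Set.Iio c) = ENNReal.ofReal c := by
    intro c
    rw [Measure.map_apply hm measurableSet_Iio]
    have : (fun x : EuclideanSpace ℝ (Fin 2) => b * Real.pi * ‖x‖ ^ 2) ⁻¹' Set.Iio c =
        Metric.ball 0 (Real.sqrt (c / (b * Real.pi))) := by
      ext x
      rw [mem_ball_zero_iff, Real.lt_sqrt (norm_nonneg x), lt_div_iff₀ hbp, Set.mem_preimage,
        Set.mem_Iio, mul_comm]
    rw [this, Measure.smul_apply, EuclideanSpace.volume_ball_fin_two, smul_eq_mul,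
      ← ENNReal.ofReal_pow (Real.sqrt_nonneg _), ← ENNReal.ofReal_mul (by positivity),
      ← ENNReal.ofReal_mul hb.le]
    rcases le_total 0 c with hc | hc
    · rw [Real.sq_sqrt (by positivity)]
      congr 1
      field_simp
    · rw [Real.sqrt_eq_zero_of_nonpos (div_nonpos_of_nonpos_of_nonneg hc hbp.le)]
      simp [ENNReal.ofReal_of_nonpos hc]
  have hIio' : ∀ c : ℝ, volume.restrict (Set.Ici (0 : ℝ)) (Set.Iio c) = ENNReal.ofReal c := by
    intro c
    rw [Measure.restrict_apply measurableSet_Iio, Set.inter_comm, Set.Ici_inter_Iio,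
      Real.volume_Ico, sub_zero]
  refine (Measure.ext_of_Ico _ _ fun x y hxy => ?_).symm
  rw [← Set.Iio_sdiff_Iio, measure_sdiff (Set.Iio_subset_Iio hxy.le) nullMeasurableSet_Iio
    (by rw [hIio']; exact ENNReal.ofReal_ne_top), measure_sdiff (Set.Iio_subset_Iio hxy.le)
    nullMeasurableSet_Iio (by rw [hIio]; exact ENNReal.ofReal_ne_top), hIio, hIio, hIio', hIio']

lemma lintegral_Ioi_div {s : ℝ} (hs : 0 < s) (g : ℝ → ℝ≥0∞) :
    ∫⁻ w in Set.Ioi s, g (w / s) = ENNReal.ofReal s * ∫⁻ u in Set.Ioi 1, g u := by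
  have himg : (fun u : ℝ => s * u) '' Set.Ioi 1 = Set.Ioi s := by
    rw [Set.image_mul_left_Ioi hs, mul_one]
  rw [← himg, lintegral_image_eq_lintegral_abs_deriv_mul measurableSet_Ioi
    (fun x _ => ((hasDerivAt_id' x).const_mul s).hasDerivWithinAt)
    (fun x _ y _ h => mul_left_cancel₀ hs.ne' h)]
  simp only [mul_one, abs_of_pos hs]
  simp_rw [mul_div_cancel_left₀ _ hs.ne']
  rw [lintegral_const_mul' _ _ ENNReal.ofReal_ne_top]

/-! ### Poisson processes on the half line seen from their first point -/

section HalfLine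

variable {Ω : Type*} [MeasurableSpace Ω] {μ : Measure Ω}

/-- The sum of `h (w / s)` over the points `w > s` of a sequence. -/
def ratioSum (h : ℝ → ℝ≥0∞) (s : ℝ) (v : ℕ → ℝ) : ℝ≥0∞ :=
  ∑' k, if s < v k then h (v k / s) else 0

lemma measurable_ratioSum {h : ℝ → ℝ≥0∞} (hh : Measurable h) {V : ℕ → Ω → ℝ}
    (hV : ∀ k, Measurable (V k)) {s : Ω → ℝ} (hs : Measurable s) :
    Measurable fun ω => ratioSum h (s ω) fun k => V k ω :=
  Measurable.tsum fun k => Measurable.ite (measurableSet_lt hs (hV k))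
    (hh.comp ((hV k).div hs)) measurable_const

/-- The event that no point lies below r is absorbed into the Laplace functional by giving the test
function the value ∞ there. Since r ≤ s, the two parts of the test function have disjoint supports
and contribute r and, after rescaling, s times the integral over (1, ∞). -/
lemma setLIntegral_expNeg_ratioSum [IsFiniteMeasure μ] {V : ℕ → Ω → ℝ}
    (hV : IsPoissonPointProcess V (volume.restrict (Set.Ici 0)) μ) (hV0 : ∀ k ω, 0 ≤ V k ω)
    {h : ℝ → ℝ≥0∞} (hh : Measurable h) {r s : ℝ} (hrs : r ≤ s) (hs : 0 < s) :
    ∫⁻ ω in {ω | r ≤ ⨅ k, V k ω}, expNeg (ratioSum h s fun k => V k ω) ∂μ =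
      expNeg (ENNReal.ofReal r +
        ENNReal.ofReal s * ∫⁻ u in Set.Ioi 1, (1 - expNeg (h u))) := by
  have hA : MeasurableSet {ω | r ≤ ⨅ k, V k ω} :=
    measurableSet_le measurable_const (Measurable.iInf hV.measurable)
  let F : ℝ → ℝ≥0∞ := fun w => (if w < r then ∞ else 0) + if s < w then h (w / s) else 0
  have hF : Measurable F :=
    (Measurable.ite measurableSet_Iio measurable_const measurable_const).add
      (Measurable.ite measurableSet_Ioi (hh.comp (measurable_id.div_const s)) measurable_const)
  have h1 : ∀ ω, {ω | r ≤ ⨅ k, V k ω}.indicator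
      (fun ω => expNeg (ratioSum h s fun k => V k ω)) ω = expNeg (∑' k, F (V k ω)) := by
    intro ω
    have hbdd : BddBelow (Set.range fun k => V k ω) := ⟨0, by rintro _ ⟨k, rfl⟩; exact hV0 k ω⟩
    by_cases hω : r ≤ ⨅ k, V k ω
    · rw [Set.indicator_of_mem (by exact hω), ratioSum]
      congr 1
      refine tsum_congr fun k => ?_
      have : ¬ V k ω < r := not_lt.2 (hω.trans (ciInf_le hbdd k))
      simp [F, this]
    · rw [Set.indicator_of_notMem (by exact hω)]
      obtain ⟨k, hk⟩ := exists_lt_of_ciInf_lt (not_le.1 hω)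
      have : ∑' k, F (V k ω) = ∞ := ENNReal.tsum_eq_top_of_eq_top ⟨k, by simp [F, hk]⟩
      rw [this, expNeg_top]
  rw [← lintegral_indicator hA]
  simp_rw [h1]
  rw [hV.laplace hF]
  congr 1
  have h2 : ∀ w ∈ Set.Ici (0 : ℝ), 1 - expNeg (F w) = (Set.Ico 0 r).indicator 1 w +
      (Set.Ioi s).indicator (fun w => 1 - expNeg (h (w / s))) w := by
    intro w hw
    rcases lt_or_ge w r with h' | h'
    · have : w ∉ Set.Ioi s := fun h'' => absurd (h'.trans_le hrs) (not_lt.2 (le_of_lt h''))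
      rw [Set.indicator_of_notMem this, Set.indicator_of_mem (show w ∈ Set.Ico 0 r from ⟨hw, h'⟩)]
      simp [F, h']
    · have : w ∉ Set.Ico 0 r := fun h'' => absurd h''.2 (not_lt.2 h')
      rw [Set.indicator_of_notMem this, zero_add]
      by_cases h'' : s < w
      · rw [Set.indicator_of_mem (show w ∈ Set.Ioi s from h'')]
        simp [F, h'', not_lt.2 h']
      · rw [Set.indicator_of_notMem (show w ∉ Set.Ioi s from h'')]
        simp [F, h'', not_lt.2 h']
  rw [setLIntegral_congr_fun measurableSet_Ici h2, lintegral_add_left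
    (measurable_one.indicator measurableSet_Ico), lintegral_indicator_one measurableSet_Ico,
    lintegral_indicator measurableSet_Ioi, Measure.restrict_restrict measurableSet_Ioi,
    Set.inter_eq_left.2 (show Set.Ioi s ⊆ Set.Ici 0 from fun w hw => hs.le.trans (le_of_lt hw)),
    lintegral_Ioi_div hs (fun u => 1 - expNeg (h u)), Measure.restrict_apply measurableSet_Ico,
    Set.inter_eq_left.2 (show Set.Ico 0 r ⊆ Set.Ici 0 from fun w hw => hw.1),
    Real.volume_Ico, sub_zero]

/-- The case h = 0 above gives P(r ≤ first point) = e^{-r}, which tends to 1 as r → 0. -/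
lemma ae_pos_iInf [IsProbabilityMeasure μ] {V : ℕ → Ω → ℝ}
    (hV : IsPoissonPointProcess V (volume.restrict (Set.Ici 0)) μ) (hV0 : ∀ k ω, 0 ≤ V k ω) :
    ∀ᵐ ω ∂μ, 0 < ⨅ k, V k ω := by
  have hmeas : Measurable fun ω => ⨅ k, V k ω := Measurable.iInf hV.measurable
  have hb : ∀ r : ℝ, 0 < r → expNeg (ENNReal.ofReal r) ≤ μ {ω | 0 < ⨅ k, V k ω} := by
    intro r hr
    have := setLIntegral_expNeg_ratioSum hV hV0 (h := fun _ => 0) measurable_const le_rfl hr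
    simp only [ratioSum, ite_self, tsum_zero, expNeg_zero, lintegral_const, one_mul, tsub_self,
      zero_mul, mul_zero, add_zero, Measure.restrict_apply MeasurableSet.univ,
      Set.univ_inter] at this
    rw [← this]
    exact measure_mono fun ω hω => hr.trans_le hω
  have hlim : Tendsto (fun r : ℝ => expNeg (ENNReal.ofReal r)) (𝓝[>] 0) (𝓝 1) := by
    rw [← expNeg_zero, ← ENNReal.ofReal_zero]
    exact ((continuous_expNeg.comp ENNReal.continuous_ofReal).tendsto 0).mono_left
      nhdsWithin_le_nhds
  have h1 : (1 : ℝ≥0∞) ≤ μ {ω | 0 < ⨅ k, V k ω} :=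
    le_of_tendsto hlim (by filter_upwards [self_mem_nhdsWithin] with r hr using hb r hr)
  have hS : MeasurableSet {ω | 0 < ⨅ k, V k ω} := measurableSet_lt measurable_const hmeas
  rw [ae_iff_prob_eq_one (measurableSet_setOfPred.1 hS)]
  exact le_antisymm prob_le_one h1

lemma ae_tsum_rpow_lt_top [IsProbabilityMeasure μ] {V : ℕ → Ω → ℝ}
    (hV : IsPoissonPointProcess V (volume.restrict (Set.Ici 0)) μ) {γ : ℝ} (hγ : 1 < γ) :
    ∀ᵐ ω ∂μ, ∑' k, ENNReal.ofReal ((1 + ‖V k ω‖) ^ (-γ)) < ∞ := by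
  refine hV.ae_tsum_lt_top (F := fun w => ENNReal.ofReal ((1 + ‖w‖) ^ (-γ)))
    (by fun_prop) ?_
  have : Integrable (fun w : ℝ => (1 + ‖w‖) ^ (-γ)) (volume.restrict (Set.Ici 0)) :=
    (integrable_one_add_norm (by simpa using hγ)).integrableOn
  exact this.lintegral_lt_top.ne

/-- Holds because 1 + w ≤ (1 + v⁻¹) w for w > v. It compares the terms beyond the first point with
the sum of `ae_tsum_rpow_lt_top`, for dominated convergence. -/
lemma rpow_neg_le_of_lt {v w γ : ℝ} (hv : 0 < v) (hw : v < w) (hγ : 0 ≤ γ) :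
    w ^ (-γ) ≤ (1 + v⁻¹) ^ γ * (1 + ‖w‖) ^ (-γ) := by
  have hw0 : 0 < w := hv.trans hw
  rw [Real.norm_of_nonneg hw0.le, Real.rpow_neg hw0.le, Real.rpow_neg (by positivity),
    ← div_eq_mul_inv, ← Real.div_rpow (by positivity) (by positivity), ← Real.inv_rpow hw0.le]
  refine Real.rpow_le_rpow (by positivity) ?_ hγ
  rw [le_div_iff₀ (by positivity), inv_mul_le_iff₀ hw0]
  have : 1 ≤ w * v⁻¹ := by rw [← div_eq_mul_inv, one_le_div hv]; exact hw.le
  nlinarith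

/-- Only the right limit works: a point beyond m is eventually counted as s decreases to m, and a
point at or below m is never counted for s > m. -/
lemma tendsto_ratioSum {h : ℝ → ℝ≥0∞} (hc : ContinuousOn h (Set.Ioi 1)) {C γ : ℝ} (hγ : 0 ≤ γ)
    (hC : 0 ≤ C) (hb : ∀ u, 1 < u → h u ≤ ENNReal.ofReal (C * u ^ (-γ))) {v : ℕ → ℝ} {m : ℝ}
    (hm : 0 < m) (hv : ∑' k, ENNReal.ofReal ((1 + ‖v k‖) ^ (-γ)) < ∞) :
    Tendsto (fun s => ratioSum h s v) (𝓝[>] m) (𝓝 (ratioSum h m v)) := by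
  simp only [ratioSum, ← lintegral_count]
  -- The factor (m + 1)^γ bounds s^γ for s < m + 1; the last factor comes from `rpow_neg_le_of_lt`.
  let D : ℝ := C * (m + 1) ^ γ * (1 + m⁻¹) ^ γ
  refine tendsto_lintegral_filter_of_dominated_convergence
    (fun k => ENNReal.ofReal D * ENNReal.ofReal ((1 + ‖v k‖) ^ (-γ)))
    (Eventually.of_forall fun _ => measurable_of_countable _) ?_ ?_ (ae_of_all _ fun k => ?_)
  · have : Set.Ioo m (m + 1) ∈ 𝓝[>] m := Ioo_mem_nhdsGT (by linarith)
    filter_upwards [this] with s hs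
    refine ae_of_all _ fun k => ?_
    have hs0 : 0 < s := hm.trans hs.1
    split_ifs with hk
    · refine (hb _ ((one_lt_div hs0).2 hk)).trans ?_
      rw [← ENNReal.ofReal_mul (by positivity)]
      refine ENNReal.ofReal_le_ofReal ?_
      have hk0 : 0 < v k := hs0.trans hk
      have h1 : (v k / s) ^ (-γ) = s ^ γ * (v k) ^ (-γ) := by
        rw [Real.div_rpow hk0.le hs0.le, Real.rpow_neg hs0.le, div_inv_eq_mul, mul_comm]
      have h2 : s ^ γ ≤ (m + 1) ^ γ := Real.rpow_le_rpow hs0.le hs.2.le hγ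
      have h3 := rpow_neg_le_of_lt hm (hs.1.trans hk) hγ
      rw [h1]
      calc C * (s ^ γ * (v k) ^ (-γ))
          ≤ C * ((m + 1) ^ γ * ((1 + m⁻¹) ^ γ * (1 + ‖v k‖) ^ (-γ))) := by gcongr
        _ = D * (1 + ‖v k‖) ^ (-γ) := by simp only [D]; ring
    · exact zero_le
  · rw [lintegral_const_mul' _ _ ENNReal.ofReal_ne_top, lintegral_count]
    exact ENNReal.mul_ne_top ENNReal.ofReal_ne_top hv.ne
  · by_cases hk : m < v k
    · have hev : ∀ᶠ s in 𝓝[>] m, s < v k := nhdsWithin_le_nhds (Iio_mem_nhds hk)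
      rw [if_pos hk]
      refine Tendsto.congr' (f₁ := fun s => h (v k / s))
        (by filter_upwards [hev] with s hs; rw [if_pos hs]) ?_
      have h1 : ContinuousAt h (v k / m) :=
        hc.continuousAt (Ioi_mem_nhds ((one_lt_div hm).2 hk))
      exact h1.tendsto.comp
        ((tendsto_const_nhds.div tendsto_id hm.ne').mono_left nhdsWithin_le_nhds)
    · rw [if_neg hk]
      refine tendsto_const_nhds.congr' ?_
      filter_upwards [self_mem_nhdsWithin] with s hs
      rw [if_neg (not_lt.2 ((not_lt.1 hk).trans (le_of_lt hs)))]

/-- A quotient of the slopes at 0 of 1 - e^{-δ} and 1 - e^{-δ(1+κ)}. -/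
lemma tendsto_geometric_ratio {κ : ℝ} (hκ : 0 ≤ κ) :
    Tendsto (fun δ : ℝ => (1 - Real.exp (-δ)) * Real.exp (-(δ * κ)) *
      (1 - Real.exp (-(δ * (1 + κ))))⁻¹) (𝓝[>] 0) (𝓝 (1 + κ)⁻¹) := by
  have hslope : ∀ c : ℝ, Tendsto (fun δ : ℝ => δ⁻¹ * (1 - Real.exp (-(δ * c)))) (𝓝[>] 0) (𝓝 c) := by
    intro c
    have h1 : HasDerivAt (fun δ : ℝ => 1 - Real.exp (-(δ * c))) c 0 := by
      have := (((hasDerivAt_id (0 : ℝ)).mul_const c).neg.exp).const_sub 1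
      simpa using this
    have h2 := h1.tendsto_slope_zero_right
    simpa using h2
  have h3 : Tendsto (fun δ : ℝ => Real.exp (-(δ * κ))) (𝓝[>] 0) (𝓝 1) := by
    have : Continuous fun δ : ℝ => Real.exp (-(δ * κ)) := by fun_prop
    simpa using (this.tendsto 0).mono_left nhdsWithin_le_nhds
  have h4 := ((hslope 1).mul h3).mul ((hslope (1 + κ)).inv₀ (by positivity))
  simp only [mul_one, one_mul] at h4
  refine h4.congr' ?_
  filter_upwards [self_mem_nhdsWithin] with δ hδ
  have : (δ : ℝ) ≠ 0 := ne_of_gt hδ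
  rw [mul_inv, inv_inv]
  field_simp

/-- The right end of the cell of the mesh `δ ℕ` that contains `x`. -/
def cellEnd (δ x : ℝ) : ℝ := (⌊x / δ⌋₊ + 1) * δ

/-- On the cell nδ ≤ m < (n+1)δ the threshold is the constant s = (n+1)δ, so the integral is the
difference of `setLIntegral_expNeg_ratioSum` at r = nδ and r = (n+1)δ. Taking the right end ensures
r ≤ s in both. Summing over n gives a geometric series. -/
lemma lintegral_expNeg_ratioSum_cellEnd [IsFiniteMeasure μ] {V : ℕ → Ω → ℝ}
    (hV : IsPoissonPointProcess V (volume.restrict (Set.Ici 0)) μ) (hV0 : ∀ k ω, 0 ≤ V k ω)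
    {h : ℝ → ℝ≥0∞} (hh : Measurable h) {κ : ℝ} (hκ : 0 ≤ κ)
    (hint : ∫⁻ u in Set.Ioi 1, (1 - expNeg (h u)) = ENNReal.ofReal κ) {δ : ℝ} (hδ : 0 < δ) :
    ∫⁻ ω, expNeg (ratioSum h (cellEnd δ (⨅ k, V k ω)) fun k => V k ω) ∂μ =
      ENNReal.ofReal ((1 - Real.exp (-δ)) * Real.exp (-(δ * κ)) *
        (1 - Real.exp (-(δ * (1 + κ))))⁻¹) := by
  have hmeas : Measurable fun ω => ⨅ k, V k ω := Measurable.iInf hV.measurable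
  let A : ℕ → Set Ω := fun n => {ω | n * δ ≤ ⨅ k, V k ω}
  have hA : ∀ n, MeasurableSet (A n) := fun n => measurableSet_le measurable_const hmeas
  have hsub : ∀ n, A (n + 1) ⊆ A n := fun n ω hω => by
    refine le_trans ?_ (show ((n + 1 : ℕ) : ℝ) * δ ≤ _ from hω)
    push_cast; nlinarith
  have hm0 : ∀ ω, 0 ≤ ⨅ k, V k ω := fun ω => Real.iInf_nonneg fun k => hV0 k ω
  have hfl : ∀ n ω, ω ∈ A n \ A (n + 1) ↔ ⌊(⨅ k, V k ω) / δ⌋₊ = n := by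
    intro n ω
    rw [Nat.floor_eq_iff (div_nonneg (hm0 ω) hδ.le), le_div_iff₀ hδ, div_lt_iff₀ hδ]
    simp [A]
  have hcell : ∀ n : ℕ, ∫⁻ ω in A n \ A (n + 1),
      expNeg (ratioSum h (cellEnd δ (⨅ k, V k ω)) fun k => V k ω) ∂μ =
      ENNReal.ofReal ((1 - Real.exp (-δ)) * Real.exp (-(δ * κ)) *
        Real.exp (-(δ * (1 + κ))) ^ n) := by
    intro n
    have hs : (0 : ℝ) < (n + 1) * δ := by positivity
    have e1 : ∫⁻ ω in A n \ A (n + 1),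
        expNeg (ratioSum h (cellEnd δ (⨅ k, V k ω)) fun k => V k ω) ∂μ =
        ∫⁻ ω in A n \ A (n + 1), expNeg (ratioSum h ((n + 1) * δ) fun k => V k ω) ∂μ :=
      setLIntegral_congr_fun ((hA n).diff (hA _)) fun ω hω => by
        simp only [cellEnd, (hfl n ω).1 hω]
    have e2 := setLIntegral_expNeg_ratioSum hV hV0 hh (r := n * δ) (s := (n + 1) * δ)
      (by nlinarith) hs
    have e3 := setLIntegral_expNeg_ratioSum hV hV0 hh (r := (n + 1 : ℕ) * δ) (s := (n + 1) * δ)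
      (by push_cast; exact le_rfl) hs
    have e4 := lintegral_inter_add_sdiff (μ := μ)
      (fun ω => expNeg (ratioSum h ((n + 1) * δ) fun k => V k ω)) (A n) (hA (n + 1))
    rw [Set.inter_eq_right.2 (hsub n)] at e4
    rw [hint, ← ENNReal.ofReal_mul hs.le, ← ENNReal.ofReal_add (by positivity) (by positivity),
      expNeg_ofReal (by positivity)] at e2 e3
    rw [e1]
    have e5 : ∫⁻ ω in A (n + 1), expNeg (ratioSum h ((n + 1) * δ) fun k => V k ω) ∂μ ≠ ∞ := by
      rw [e3]; exact ENNReal.ofReal_ne_top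
    rw [ENNReal.eq_sub_of_add_eq' (by rw [e2]; exact ENNReal.ofReal_ne_top)
      ((add_comm _ _).trans e4), e2, e3, ← ENNReal.ofReal_sub _ (Real.exp_pos _).le]
    congr 1
    rw [← Real.exp_nat_mul, sub_mul, sub_mul, one_mul, ← Real.exp_add, ← Real.exp_add,
      ← Real.exp_add]
    push_cast
    congr 2 <;> ring
  have hunion : (⋃ n, A n \ A (n + 1)) = Set.univ :=
    Set.eq_univ_of_forall fun ω => Set.mem_iUnion.2 ⟨_, (hfl _ ω).2 rfl⟩
  have hdisj : Pairwise (Function.onFun Disjoint fun n => A n \ A (n + 1)) := fun i j hij =>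
    Set.disjoint_left.2 fun ω hi hj => hij (((hfl i ω).1 hi).symm.trans ((hfl j ω).1 hj))
  rw [← setLIntegral_univ, ← hunion,
    lintegral_iUnion (fun n => (hA n).diff (hA _)) hdisj]
  simp_rw [hcell]
  have hq : Real.exp (-(δ * (1 + κ))) < 1 := by
    rw [Real.exp_lt_one_iff, neg_lt_zero]; positivity
  have h1 : 0 ≤ 1 - Real.exp (-δ) := by
    rw [sub_nonneg, Real.exp_le_one_iff]; linarith
  have hg := (hasSum_geometric_of_lt_one (Real.exp_pos _).le hq).mul_left
    ((1 - Real.exp (-δ)) * Real.exp (-(δ * κ)))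
  rw [← ENNReal.ofReal_tsum_of_nonneg (fun n => by positivity) hg.summable, hg.tsum_eq]

lemma tendsto_cellEnd {x : ℝ} (hx : 0 ≤ x) : Tendsto (fun δ => cellEnd δ x) (𝓝[>] 0) (𝓝[>] x) := by
  have hgt : ∀ δ > 0, x < cellEnd δ x := fun δ hδ => by
    rw [cellEnd, ← div_lt_iff₀ hδ]
    exact Nat.lt_floor_add_one _
  have hle : ∀ δ > 0, cellEnd δ x ≤ x + δ := fun δ hδ => by
    rw [cellEnd, add_mul, one_mul]
    gcongr
    rw [← le_div_iff₀ hδ]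
    exact Nat.floor_le (by positivity)
  refine tendsto_nhdsWithin_iff.2 ⟨?_, by
    filter_upwards [self_mem_nhdsWithin] with δ hδ using hgt δ hδ⟩
  have h1 : Tendsto (fun δ : ℝ => x + δ) (𝓝[>] 0) (𝓝 x) := by
    have : Continuous fun δ : ℝ => x + δ := by fun_prop
    simpa using (this.tendsto 0).mono_left nhdsWithin_le_nhds
  refine tendsto_of_tendsto_of_tendsto_of_le_of_le' tendsto_const_nhds h1 ?_ ?_
  · filter_upwards [self_mem_nhdsWithin] with δ hδ using (hgt δ hδ).le
  · filter_upwards [self_mem_nhdsWithin] with δ hδ using hle δ hδ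

/-- The Laplace functional of the ratios of the points of a Poisson process on the half line to
its first point. -/
theorem lintegral_expNeg_ratioSum [IsProbabilityMeasure μ] {V : ℕ → Ω → ℝ}
    (hV : IsPoissonPointProcess V (volume.restrict (Set.Ici 0)) μ) (hV0 : ∀ k ω, 0 ≤ V k ω)
    {h : ℝ → ℝ≥0∞} (hh : Measurable h) (hc : ContinuousOn h (Set.Ioi 1)) {C γ : ℝ} (hγ : 1 < γ)
    (hC : 0 ≤ C) (hb : ∀ u, 1 < u → h u ≤ ENNReal.ofReal (C * u ^ (-γ))) {κ : ℝ} (hκ : 0 ≤ κ)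
    (hint : ∫⁻ u in Set.Ioi 1, (1 - expNeg (h u)) = ENNReal.ofReal κ) :
    ∫⁻ ω, expNeg (ratioSum h (⨅ k, V k ω) fun k => V k ω) ∂μ = ENNReal.ofReal (1 + κ)⁻¹ := by
  have hmeas : Measurable fun ω => ⨅ k, V k ω := Measurable.iInf hV.measurable
  have h1 : Tendsto (fun δ : ℝ =>
      ∫⁻ ω, expNeg (ratioSum h (cellEnd δ (⨅ k, V k ω)) fun k => V k ω) ∂μ) (𝓝[>] 0)
      (𝓝 (∫⁻ ω, expNeg (ratioSum h (⨅ k, V k ω) fun k => V k ω) ∂μ)) := by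
    refine tendsto_lintegral_filter_of_dominated_convergence (fun _ => 1)
      (Eventually.of_forall fun δ => ?_) (Eventually.of_forall fun δ => ae_of_all _ fun ω =>
        expNeg_le_one _) (by simp) ?_
    · refine measurable_expNeg.comp (measurable_ratioSum hh hV.measurable ?_)
      unfold cellEnd
      fun_prop
    · filter_upwards [ae_pos_iInf hV hV0, ae_tsum_rpow_lt_top hV hγ] with ω hω hω'
      exact (continuous_expNeg.tendsto _).comp
        ((tendsto_ratioSum hc (by linarith) hC hb hω hω').comp (tendsto_cellEnd hω.le))
  have h2 := (ENNReal.continuous_ofReal.tendsto _).comp (tendsto_geometric_ratio hκ)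
  refine tendsto_nhds_unique h1 (h2.congr' ?_)
  filter_upwards [self_mem_nhdsWithin] with δ hδ
  exact (lintegral_expNeg_ratioSum_cellEnd hV hV0 hh hκ hint hδ).symm

end HalfLine

/-! ### Independent marks and Rayleigh fading -/

/-- Independence factors the finite products; dominated convergence with bound 1 passes to the
infinite one. -/
lemma lintegral_infinitePi_expNeg_tsum {Y : Type*} [MeasurableSpace Y] (ν : Measure Y)
    [IsProbabilityMeasure ν] {F : ℕ → Y → ℝ≥0∞} (hF : ∀ k, Measurable (F k)) :
    ∫⁻ m, expNeg (∑' k, F k (m k)) ∂(Measure.infinitePi fun _ : ℕ => ν) =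
      expNeg (∑' k, negLog (∫⁻ y, expNeg (F k y) ∂ν)) := by
  have hle : ∀ k, ∫⁻ y, expNeg (F k y) ∂ν ≤ 1 := fun k =>
    (lintegral_mono fun y => expNeg_le_one _).trans (by simp)
  have hm : ∀ k, Measurable fun y => expNeg (F k y) := fun k => measurable_expNeg.comp (hF k)
  have hfin : ∀ n, ∫⁻ m, ∏ k ∈ Finset.range n, expNeg (F k (m k))
      ∂(Measure.infinitePi fun _ : ℕ => ν) =
      ∏ k ∈ Finset.range n, expNeg (negLog (∫⁻ y, expNeg (F k y) ∂ν)) := fun n => by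
    rw [lintegral_prod_eq_prod_lintegral_of_indepFun (Finset.range n)
      (fun k (m : ℕ → Y) => expNeg (F k (m k))) (iIndepFun_infinitePi hm)
      (fun k => (hm k).comp (measurable_pi_apply k))]
    refine Finset.prod_congr rfl fun k _ => ?_
    rw [expNeg_negLog (hle k),
      (measurePreserving_eval_infinitePi (fun _ : ℕ => ν) k).lintegral_comp (hm k)]
  refine tendsto_nhds_unique ?_ (tendsto_prod_expNeg _)
  simp_rw [← hfin]
  refine tendsto_lintegral_of_dominated_convergence (fun _ => 1) (fun n => ?_)
    (fun n => ae_of_all _ fun m => Finset.prod_le_one' fun k _ => expNeg_le_one _) (by simp)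
    (ae_of_all _ fun m => tendsto_prod_expNeg _)
  exact Finset.measurable_prod _ fun k _ => (hm k).comp (measurable_pi_apply k)

/-- The integrand times the density of rate 1 is (1 + t)⁻¹ times the density of rate 1 + t. -/
lemma lintegral_expMeasure_expNeg {t : ℝ} (ht : 0 ≤ t) :
    ∫⁻ x, expNeg (ENNReal.ofReal (t * x)) ∂(expMeasure 1) = ENNReal.ofReal (1 + t)⁻¹ := by
  have h1 : expMeasure 1 = volume.withDensity (exponentialPDF 1) := rfl
  have hm : ∀ r, Measurable (exponentialPDF r) := fun r =>
    (measurable_exponentialPDFReal r).ennreal_ofReal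
  rw [h1, lintegral_withDensity_eq_lintegral_mul _ (hm 1) (by fun_prop)]
  have h2 : ∀ x, (exponentialPDF 1 * fun x => expNeg (ENNReal.ofReal (t * x))) x =
      ENNReal.ofReal (1 + t)⁻¹ * exponentialPDF (1 + t) x := by
    intro x
    rw [Pi.mul_apply]
    rcases lt_or_ge x 0 with hx | hx
    · rw [exponentialPDF_of_neg hx, exponentialPDF_of_neg hx, zero_mul, mul_zero]
    · rw [exponentialPDF_of_nonneg hx, exponentialPDF_of_nonneg hx,
        expNeg_ofReal (by positivity), ← ENNReal.ofReal_mul (by positivity),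
        ← ENNReal.ofReal_mul (by positivity)]
      congr 1
      rw [one_mul, inv_mul_cancel_left₀ (by positivity), ← Real.exp_add]
      congr 1; ring
  simp_rw [h2]
  rw [lintegral_const_mul _ (hm _), lintegral_exponentialPDF_eq_one (by positivity), mul_one]

lemma expMeasure_Ici {y : ℝ} (hy : 0 ≤ y) :
    expMeasure 1 (Set.Ici y) = expNeg (ENNReal.ofReal y) := by
  have := isProbabilityMeasure_expMeasure one_pos
  have h0 : expMeasure 1 {y} = 0 :=
    withDensity_absolutelyContinuous (μ := volume) _ Real.volume_singleton
  have h1 : expMeasure 1 (Set.Ici y) = expMeasure 1 (Set.Ioi y) := by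
    rw [← Set.Ioi_union_left]
    refine le_antisymm ((measure_union_le _ _).trans ?_) (measure_mono Set.subset_union_left)
    rw [h0, add_zero]
  rw [h1, ← Set.compl_Iic, prob_compl_eq_one_sub measurableSet_Iic, ← ofReal_cdf,
    cdf_expMeasure_eq one_pos, if_pos hy, one_mul, ← ENNReal.ofReal_one,
    ← ENNReal.ofReal_sub _ (by rw [sub_nonneg, Real.exp_le_one_iff]; linarith),
    expNeg_ofReal hy]
  congr 1; ring

/-! ### The interference functional -/

lemma antitone_negLog : Antitone negLog := fun _ _ h =>
  EReal.toENNReal_le_toENNReal (EReal.neg_le_neg_iff.2 (ENNReal.log_monotone h))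

lemma negLog_inv_le {t : ℝ} (ht : 0 ≤ t) : negLog (ENNReal.ofReal (1 + t)⁻¹) ≤ ENNReal.ofReal t := by
  rw [negLog_ofReal (by positivity)]
  refine ENNReal.ofReal_le_ofReal ?_
  rw [Real.log_inv, neg_neg]
  have := Real.log_le_sub_one_of_pos (show 0 < 1 + t by positivity)
  linarith

/-- The contribution to the exponent of an interferer whose squared distance is `u` times that of
the serving base station and which is active with probability `a`. -/
def interferenceLog (a x γ u : ℝ) : ℝ≥0∞ :=
  negLog (ENNReal.ofReal (1 - a + a * (1 + x * u ^ (-γ))⁻¹))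

section

variable {a x γ : ℝ}

lemma inv_le_mix (ha1 : a ≤ 1) {t : ℝ} (ht : 0 ≤ t) :
    (1 + t)⁻¹ ≤ 1 - a + a * (1 + t)⁻¹ := by
  have h1 : (1 + t)⁻¹ ≤ 1 := inv_le_one_of_one_le₀ (by linarith)
  nlinarith

lemma mix_le_one (ha0 : 0 ≤ a) {t : ℝ} (ht : 0 ≤ t) :
    1 - a + a * (1 + t)⁻¹ ≤ 1 := by
  have h1 : (1 + t)⁻¹ ≤ 1 := inv_le_one_of_one_le₀ (by linarith)
  nlinarith

lemma measurable_interferenceLog : Measurable (interferenceLog a x γ) := by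
  unfold interferenceLog
  fun_prop

lemma continuousOn_interferenceLog (ha1 : a ≤ 1) (hx : 0 ≤ x) :
    ContinuousOn (interferenceLog a x γ) (Set.Ioi 1) := by
  have hpos : ∀ u ∈ Set.Ioi (1 : ℝ), 0 < 1 - a + a * (1 + x * u ^ (-γ))⁻¹ := fun u hu => by
    have hu0 : (0 : ℝ) < u := one_pos.trans hu
    exact lt_of_lt_of_le (by positivity) (inv_le_mix ha1 (t := x * u ^ (-γ)) (by positivity))
  have h1 : ContinuousOn (fun u : ℝ => 1 - a + a * (1 + x * u ^ (-γ))⁻¹) (Set.Ioi 1) := by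
    intro u hu
    have hu0 : (0 : ℝ) < u := one_pos.trans hu
    have h2 : ContinuousAt (fun u : ℝ => u ^ (-γ)) u :=
      Real.continuousAt_rpow_const _ _ (Or.inl hu0.ne')
    have h3 : (1 + x * u ^ (-γ)) ≠ 0 := by positivity
    exact (continuousAt_const.add (continuousAt_const.mul
      ((continuousAt_const.add (continuousAt_const.mul h2)).inv₀ h3))).continuousWithinAt
  refine ContinuousOn.congr (f := fun u => ENNReal.ofReal
    (-Real.log (1 - a + a * (1 + x * u ^ (-γ))⁻¹))) ?_ fun u hu => negLog_ofReal (hpos u hu)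
  exact ENNReal.continuous_ofReal.comp_continuousOn
    ((h1.log fun u hu => (hpos u hu).ne').neg)

lemma interferenceLog_le (ha1 : a ≤ 1) (hx : 0 ≤ x) {u : ℝ} (hu : 1 < u) :
    interferenceLog a x γ u ≤ ENNReal.ofReal (x * u ^ (-γ)) := by
  have hu0 : (0 : ℝ) < u := one_pos.trans hu
  have ht : 0 ≤ x * u ^ (-γ) := by positivity
  exact (antitone_negLog (ENNReal.ofReal_le_ofReal (inv_le_mix ha1 ht))).trans
    (negLog_inv_le ht)

lemma image_rpow_Ioo (hγ : 0 < γ) : (fun t : ℝ => t ^ (-γ⁻¹)) '' Set.Ioo 0 1 = Set.Ioi 1 := by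
  ext u
  constructor
  · rintro ⟨t, ht, rfl⟩
    exact Real.one_lt_rpow_of_pos_of_lt_one_of_neg ht.1 ht.2 (by simpa using hγ)
  · intro hu
    have hu0 : (0 : ℝ) < u := one_pos.trans hu
    refine ⟨u ^ (-γ), ⟨by positivity, Real.rpow_lt_one_of_one_lt_of_neg hu (by linarith)⟩, ?_⟩
    simp only
    rw [← Real.rpow_mul hu0.le, neg_mul_neg, mul_inv_cancel₀ hγ.ne', Real.rpow_one]

lemma intervalIntegrable_rpow_mul_inv (hγ : 1 < γ) (hx : 0 ≤ x) :
    IntervalIntegrable (fun t : ℝ => t ^ (-γ⁻¹) * (1 + x * t)⁻¹) volume 0 1 := by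
  refine (intervalIntegral.intervalIntegrable_rpow' ?_).mul_continuousOn ?_
  · rw [neg_lt_neg_iff]
    exact inv_lt_one_of_one_lt₀ hγ
  · refine ContinuousOn.inv₀ (by fun_prop) fun t ht => ?_
    rw [Set.uIcc_of_le zero_le_one] at ht
    have := mul_nonneg hx ht.1
    positivity

/-- Substitute u = t^{-1/γ}: one minus the factor becomes a x t / (1 + x t), and the Jacobian is γ⁻¹
t^{-1/γ-1}. -/
lemma lintegral_one_sub_expNeg_interferenceLog (ha0 : 0 ≤ a) (ha1 : a ≤ 1) (hx : 0 ≤ x)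
    (hγ : 1 < γ) :
    ∫⁻ u in Set.Ioi 1, (1 - expNeg (interferenceLog a x γ u)) =
      ENNReal.ofReal (a * (x / γ * ∫ t in (0 : ℝ)..1, t ^ (-γ⁻¹) * (1 + x * t)⁻¹)) := by
  have hγ0 : 0 < γ := one_pos.trans hγ
  have hinj : Set.InjOn (fun t : ℝ => t ^ (-γ⁻¹)) (Set.Ioo 0 1) := fun s hs t ht h => by
    have := congrArg (fun z : ℝ => z ^ (-γ)) h
    simp only at this
    rwa [← Real.rpow_mul hs.1.le, ← Real.rpow_mul ht.1.le, neg_mul_neg, inv_mul_cancel₀ hγ0.ne',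
      Real.rpow_one, Real.rpow_one] at this
  have hder : ∀ t ∈ Set.Ioo (0 : ℝ) 1, HasDerivWithinAt (fun t : ℝ => t ^ (-γ⁻¹))
      (-γ⁻¹ * t ^ (-γ⁻¹ - 1)) (Set.Ioo 0 1) t := fun t ht =>
    (Real.hasDerivAt_rpow_const (Or.inl ht.1.ne')).hasDerivWithinAt
  rw [← image_rpow_Ioo hγ0, lintegral_image_eq_lintegral_abs_deriv_mul measurableSet_Ioo hder hinj]
  have h1 : ∀ t ∈ Set.Ioo (0 : ℝ) 1, ENNReal.ofReal |-γ⁻¹ * t ^ (-γ⁻¹ - 1)| *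
      (1 - expNeg (interferenceLog a x γ (t ^ (-γ⁻¹)))) =
      ENNReal.ofReal (a * (x / γ * (t ^ (-γ⁻¹) * (1 + x * t)⁻¹))) := by
    intro t ht
    have ht0 := ht.1
    have h2 : (t ^ (-γ⁻¹)) ^ (-γ) = t := by
      rw [← Real.rpow_mul ht.1.le, neg_mul_neg, inv_mul_cancel₀ hγ0.ne', Real.rpow_one]
    have hxt : 0 ≤ x * t := by positivity
    have hle := mix_le_one ha0 hxt
    rw [interferenceLog, h2, expNeg_negLog (by simpa using hle), ← ENNReal.ofReal_one,
      ← ENNReal.ofReal_sub _ (le_trans (by positivity) (inv_le_mix ha1 hxt)),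
      ← ENNReal.ofReal_mul (abs_nonneg _), abs_mul, abs_neg, abs_of_pos (inv_pos.2 hγ0),
      abs_of_nonneg (by positivity), Real.rpow_sub_one ht0.ne']
    congr 1
    have : 1 + x * t ≠ 0 := by positivity
    field_simp
    ring
  rw [setLIntegral_congr_fun measurableSet_Ioo h1]
  have hint := intervalIntegrable_rpow_mul_inv hγ hx
  rw [← intervalIntegral.integral_const_mul, ← intervalIntegral.integral_const_mul,
    intervalIntegral.integral_of_le zero_le_one, integral_Ioc_eq_integral_Ioo]
  refine (ofReal_integral_eq_lintegral_ofReal ?_ ?_).symm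
  · have := (hint.const_mul (x / γ)).const_mul a
    rw [intervalIntegrable_iff_integrableOn_Ioo_of_le zero_le_one] at this
    exact this
  · refine (ae_restrict_iff' measurableSet_Ioo).2 (ae_of_all _ fun t ht => ?_)
    have ht0 := ht.1
    positivity

end

lemma sinrThreshold_pos {c : Params} (hB : 0 < c.bandwidth) (hτ : 0 < c.slot)
    (hT : 0 < c.packetSize) : 0 < sinrThreshold c := by
  rw [sinrThreshold, sub_pos]
  exact Real.one_lt_rpow one_lt_two (by positivity)

/-- Here d - b = 1, so the power of 1 - t disappears, and Γ(b + 1) = b Γ(b) turns the prefactor into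
T̄ / (β/2). -/
lemma Z₁_eq_integral {c : Params} (hβ : 2 < c.pathLoss) (x : ℝ) :
    Z₁ c x = sinrThreshold c / (c.pathLoss / 2) *
      ∫ t in (0 : ℝ)..1, t ^ (-(c.pathLoss / 2)⁻¹) * (1 + x * t)⁻¹ := by
  have hb : 0 < 1 - 2 / c.pathLoss := by
    rw [sub_pos, div_lt_one (by linarith)]; exact hβ
  have hΓ : Real.Gamma (2 - 2 / c.pathLoss) =
      (1 - 2 / c.pathLoss) * Real.Gamma (1 - 2 / c.pathLoss) := by
    rw [← Real.Gamma_add_one hb.ne']; congr 1; ring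
  have hΓ0 : Real.Gamma (1 - 2 / c.pathLoss) ≠ 0 := (Real.Gamma_pos_of_pos hb).ne'
  rw [Z₁, gaussHypergeometric, hΓ, show 2 - 2 / c.pathLoss - (1 - 2 / c.pathLoss) = 1 by ring,
    Real.Gamma_one, ← mul_assoc]
  have h2 : c.pathLoss - 2 ≠ 0 := by linarith
  have h3 : c.pathLoss ≠ 0 := by linarith
  congr 1
  · generalize Real.Gamma (1 - 2 / c.pathLoss) = G at hΓ0
    field_simp
  · refine intervalIntegral.integral_congr fun t _ => ?_
    simp only [sub_self, Real.rpow_zero, mul_one]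
    rw [Real.rpow_neg_one, inv_div]
    congr 2 <;> ring

lemma Z₁_pos {c : Params} (hβ : 2 < c.pathLoss) (hx : 0 < sinrThreshold c) :
    0 < Z₁ c (sinrThreshold c) := by
  rw [Z₁_eq_integral hβ]
  refine mul_pos (div_pos hx (by linarith)) ?_
  refine intervalIntegral.intervalIntegral_pos_of_pos_on
    (intervalIntegrable_rpow_mul_inv (by linarith) hx.le) (fun t ht => ?_) one_pos
  have := ht.1
  positivity

/-! ### The packet loss rate of the typical user -/

/-- Whether a base station at distance `d` that transmits packet `j` interferes with a user with
serving distance `R`. -/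
def Interferes {N : ℕ} (row : Fin N → ℝ) (Rb R d : ℝ) (j : Fin N) : Prop :=
  (row j = 1 ∧ max R Rb < d) ∨ (row j ≠ 1 ∧ R < d)

lemma Interferes.lt {N : ℕ} {row : Fin N → ℝ} {Rb R d : ℝ} {j : Fin N}
    (h : Interferes row Rb R d j) : R < d :=
  h.elim (fun h => (le_max_left _ _).trans_lt h.2) fun h => h.2

section Deterministic

variable {Ω : Type*} {N : ℕ} (c : Params) (X : ℕ → Ω → EuclideanSpace ℝ (Fin 2)) (row : Fin N → ℝ)

open Classical in
lemma interference_eq (Rb : ℝ) (ω : Ω) (m : ℕ → Fin N × ℝ) :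
    cachedInterference c X row Rb ω m + uncachedInterference c X row ω m =
      ∑' k, if Interferes row Rb (servingDistance X ω) ‖X k ω‖ (m k).1 then
        ENNReal.ofReal (c.power * (m k).2 * ‖X k ω‖ ^ (-c.pathLoss)) else 0 := by
  rw [cachedInterference, uncachedInterference, ← ENNReal.tsum_add]
  refine tsum_congr fun k => ?_
  by_cases h : row (m k).1 = 1 <;> simp [h, Interferes]

end Deterministic

/-- The factor in front of the interference in the success probability given the interference. -/
def successFactor (c : Params) (R : ℝ) : ℝ := sinrThreshold c * R ^ c.pathLoss / c.power

/-- The packet arrives iff the gain is at least θD. The hypothesis D ≠ 0 matters: at D = 0 a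
positive gain gives SINR ∞, which `toReal` sends to 0, that is, to a loss. -/
lemma expMeasure_success {c : Params} (hpow : 0 < c.power)
    (hB : 0 < c.bandwidth) (hτ : 0 < c.slot) (hT : 0 < c.packetSize) {R : ℝ} (hR : 0 < R)
    {D : ℝ≥0∞} (hD : D ≠ 0) :
    expMeasure 1 {h | ¬ c.slot * c.bandwidth * Real.logb 2
      (1 + (ENNReal.ofReal (c.power * h * R ^ (-c.pathLoss)) / D).toReal) < c.packetSize} =
      expNeg (ENNReal.ofReal (successFactor c R) * D) := by
  have hx := sinrThreshold_pos hB hτ hT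
  have hθ : 0 < successFactor c R := by unfold successFactor; positivity
  by_cases hDt : D = ∞
  · rw [hDt, ENNReal.mul_top (by simpa using hθ)]
    simp [hT]
  obtain ⟨d, hd, rfl⟩ : ∃ d : ℝ, 0 < d ∧ D = ENNReal.ofReal d :=
    ⟨D.toReal, ENNReal.toReal_pos hD hDt, (ENNReal.ofReal_toReal hDt).symm⟩
  rw [← ENNReal.ofReal_mul hθ.le, ← expMeasure_Ici (by positivity)]
  congr 1
  ext h
  rw [Set.mem_ofPred_eq, Set.mem_Ici, not_lt, ← ENNReal.ofReal_div_of_pos hd,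
    ENNReal.toReal_ofReal', ← div_le_iff₀' (by positivity),
    Real.le_logb_iff_rpow_le one_lt_two (by positivity), ← sub_le_iff_le_add']
  change sinrThreshold c ≤ _ ↔ _
  -- The threshold is positive, so the branch 0 of the maximum, which covers negative gains, never
  -- succeeds.
  rw [le_max_iff, or_iff_left (not_le.2 hx), le_div_iff₀ hd, successFactor,
    Real.rpow_neg hR.le, div_mul_eq_mul_div, div_le_iff₀ hpow, ← div_eq_mul_inv,
    le_div_iff₀ (by positivity)]
  constructor <;> intro h <;> linarith

lemma isProbabilityMeasure_transmitLaw {N : ℕ} {α : Fin N → ℝ} (hα : ∀ j, 0 ≤ α j)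
    (hsum : ∑ j, α j = 1) : IsProbabilityMeasure (transmitLaw α) := by
  constructor
  rw [transmitLaw, Measure.finsetSum_apply]
  simp only [Measure.smul_apply, measure_univ, smul_eq_mul, mul_one]
  rw [← ENNReal.ofReal_sum_of_nonneg fun j _ => hα j, hsum, ENNReal.ofReal_one]

section Measurability

variable {Ω : Type*} [MeasurableSpace Ω] {N : ℕ} (c : Params)
  {X : ℕ → Ω → EuclideanSpace ℝ (Fin 2)} (row : Fin N → ℝ)

lemma measurable_servingDistance (hX : ∀ k, Measurable (X k)) : Measurable (servingDistance X) :=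
  Measurable.iInf fun k => (hX k).norm

lemma measurableSet_interferes {Y : Type*} [MeasurableSpace Y] (Rb : ℝ) {R d : Y → ℝ}
    {j : Y → Fin N} (hR : Measurable R) (hd : Measurable d) (hj : Measurable j) :
    MeasurableSet {y | Interferes row Rb (R y) (d y) (j y)} := by
  have h1 : MeasurableSet {y | row (j y) = 1} :=
    hj (MeasurableSet.of_discrete (s := {j | row j = 1}))
  exact (h1.inter (measurableSet_lt (hR.max measurable_const) hd)).union
    (h1.compl.inter (measurableSet_lt hR hd))

lemma measurable_interference (hX : ∀ k, Measurable (X k)) (Rb : ℝ) :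
    Measurable fun w : Ω × (ℕ → Fin N × ℝ) =>
      cachedInterference c X row Rb w.1 w.2 + uncachedInterference c X row w.1 w.2 := by
  classical
  simp_rw [interference_eq]
  refine Measurable.tsum fun k => Measurable.ite (measurableSet_interferes row Rb
    ((measurable_servingDistance hX).comp measurable_fst) ((hX k).comp measurable_fst).norm
    (by fun_prop)) ?_ measurable_const
  have := (hX k)
  fun_prop

lemma measurableSet_loss (hX : ∀ k, Measurable (X k)) (Rb noise : ℝ) :
    MeasurableSet {w : Ω × (ℕ → Fin N × ℝ) × ℝ | c.slot * c.bandwidth *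
      Real.logb 2 (1 + (sinr c X row Rb noise w.1 w.2.1 w.2.2).toReal) < c.packetSize} := by
  refine measurableSet_lt ?_ measurable_const
  have h1 : Measurable fun w : Ω × (ℕ → Fin N × ℝ) × ℝ =>
      sinr c X row Rb noise w.1 w.2.1 w.2.2 := by
    unfold sinr
    refine Measurable.div ?_ (((measurable_interference c row hX Rb).comp
      (measurable_fst.prodMk (measurable_fst.comp measurable_snd))).add measurable_const)
    have := measurable_servingDistance hX
    fun_prop
  have h2 : Measurable (Real.logb 2) := Real.measurable_log.div_const _
  exact (h2.comp (h1.ennreal_toReal.const_add 1)).const_mul _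

end Measurability

open Classical in
/-- The success probability factor of a base station at distance `d`. -/
def interfererFactor {N : ℕ} (c : Params) (α row : Fin N → ℝ) (Rb R d : ℝ) : ℝ :=
  ∑ j, α j * if Interferes row Rb R d j then
    (1 + sinrThreshold c * (R / d) ^ c.pathLoss)⁻¹ else 1

/-! ### Averaging over the mark of a single base station. -/

section Marks

variable {N : ℕ} {c : Params} {α row : Fin N → ℝ}

open Classical in
lemma lintegral_mark (hpow : 0 < c.power) (hx : 0 < sinrThreshold c) (hα : ∀ j, 0 ≤ α j)
    {Rb R d : ℝ} (hR : 0 < R) :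
    ∫⁻ y, expNeg (ENNReal.ofReal (successFactor c R) * (if Interferes row Rb R d y.1 then
        ENNReal.ofReal (c.power * y.2 * d ^ (-c.pathLoss)) else 0))
      ∂((transmitLaw α).prod (expMeasure 1)) =
      ENNReal.ofReal (interfererFactor c α row Rb R d) := by
  have := isProbabilityMeasure_expMeasure one_pos
  have hθ : 0 < successFactor c R := by unfold successFactor; positivity
  have hm : Measurable fun y : Fin N × ℝ => expNeg (ENNReal.ofReal (successFactor c R) *
      (if Interferes row Rb R d y.1 then
        ENNReal.ofReal (c.power * y.2 * d ^ (-c.pathLoss)) else 0)) := by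
    refine measurable_expNeg.comp (Measurable.const_mul (Measurable.ite
      (measurableSet_interferes row Rb measurable_const measurable_const measurable_fst)
      (by fun_prop) measurable_const) _)
  have hfac : ∀ j, 0 ≤ α j * (if Interferes row Rb R d j then
      (1 + sinrThreshold c * (R / d) ^ c.pathLoss)⁻¹ else 1) := fun j => by
    refine mul_nonneg (hα j) ?_
    split_ifs with h
    · have : 0 < d := hR.trans h.lt
      positivity
    · exact zero_le_one
  rw [lintegral_prod _ hm.aemeasurable, transmitLaw, lintegral_finsetSum_measure, interfererFactor,
    ENNReal.ofReal_sum_of_nonneg fun j _ => hfac j]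
  refine Finset.sum_congr rfl fun j _ => ?_
  rw [lintegral_smul_measure, lintegral_dirac, smul_eq_mul, ENNReal.ofReal_mul (hα j)]
  congr 1
  by_cases h : Interferes row Rb R d j
  · have hd : 0 < d := hR.trans h.lt
    simp only [h, if_true]
    rw [← lintegral_expMeasure_expNeg (by positivity)]
    refine lintegral_congr fun z => ?_
    rw [← ENNReal.ofReal_mul hθ.le]
    congr 2
    rw [successFactor, Real.rpow_neg hd.le, Real.div_rpow hR.le hd.le]
    field_simp
  · simp [h]

/-- The probability that a base station transmits a packet that is not in the cache. -/
def uncachedProbability {N : ℕ} (α row : Fin N → ℝ) : ℝ := 1 - ∑ j, row j * α j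

lemma uncachedProbability_eq (hsum : ∑ j, α j = 1) :
    uncachedProbability α row = ∑ j, (1 - row j) * α j := by
  simp only [uncachedProbability, sub_mul, one_mul, Finset.sum_sub_distrib, hsum]

lemma uncachedProbability_nonneg (hα : ∀ j, 0 ≤ α j) (hsum : ∑ j, α j = 1)
    (hrow : ∀ j, row j = 0 ∨ row j = 1) : 0 ≤ uncachedProbability α row := by
  rw [uncachedProbability_eq hsum]
  refine Finset.sum_nonneg fun j _ => mul_nonneg ?_ (hα j)
  rcases hrow j with h | h <;> simp [h]

lemma uncachedProbability_le_one (hα : ∀ j, 0 ≤ α j)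
    (hrow : ∀ j, row j = 0 ∨ row j = 1) : uncachedProbability α row ≤ 1 := by
  rw [uncachedProbability, sub_le_self_iff]
  refine Finset.sum_nonneg fun j _ => mul_nonneg ?_ (hα j)
  rcases hrow j with h | h <;> simp [h]

lemma interfererFactor_of_le (hsum : ∑ j, α j = 1) {Rb R d : ℝ} (hd : d ≤ R) :
    interfererFactor c α row Rb R d = 1 := by
  refine (Finset.sum_congr rfl fun j _ => ?_).trans hsum
  rw [if_neg fun h => absurd h.lt (not_lt.2 hd), mul_one]

/-- Within the cancellation radius exactly the uncached packets interfere, so the sum over packets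
collapses to a two-point mixture. -/
lemma interfererFactor_of_le_cancel (hsum : ∑ j, α j = 1) (hrow : ∀ j, row j = 0 ∨ row j = 1)
    {Rb R d : ℝ} (hd : R < d) (hb : d ≤ Rb) :
    interfererFactor c α row Rb R d = 1 - uncachedProbability α row +
      uncachedProbability α row * (1 + sinrThreshold c * (R / d) ^ c.pathLoss)⁻¹ := by
  have h1 : ∑ j, row j * α j = 1 - uncachedProbability α row := by
    rw [uncachedProbability]; ring
  rw [← h1, uncachedProbability_eq hsum, interfererFactor, Finset.sum_mul,
    ← Finset.sum_add_distrib]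
  refine Finset.sum_congr rfl fun j _ => ?_
  have h2 : ¬ max R Rb < d := not_lt.2 (hb.trans (le_max_right _ _))
  rcases hrow j with h | h
  · have : Interferes row Rb R d j := Or.inr ⟨by rw [h]; exact zero_ne_one, hd⟩
    rw [if_pos this, h]; ring
  · have : ¬ Interferes row Rb R d j := by
      rintro (h' | h')
      · exact h2 h'.2
      · exact h'.1 h
    rw [if_neg this, h]; ring

/-- A bound independent of `Rb`, hence a dominating function for the limit R_b → ∞. -/
lemma inv_le_interfererFactor (hα : ∀ j, 0 ≤ α j) (hsum : ∑ j, α j = 1)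
    (hx : 0 < sinrThreshold c) {Rb R d : ℝ} (hR : 0 < R) (hd : R < d) :
    (1 + sinrThreshold c * (R / d) ^ c.pathLoss)⁻¹ ≤ interfererFactor c α row Rb R d := by
  have hd0 := hR.trans hd
  have h1 : (1 + sinrThreshold c * (R / d) ^ c.pathLoss)⁻¹ ≤ 1 :=
    inv_le_one_of_one_le₀ (le_add_of_nonneg_right (by positivity))
  rw [interfererFactor]
  calc (1 + sinrThreshold c * (R / d) ^ c.pathLoss)⁻¹
      = ∑ j, α j * (1 + sinrThreshold c * (R / d) ^ c.pathLoss)⁻¹ := by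
        rw [← Finset.sum_mul, hsum, one_mul]
    _ ≤ _ := by
        refine Finset.sum_le_sum fun j _ => mul_le_mul_of_nonneg_left ?_ (hα j)
        split_ifs
        · exact le_rfl
        · exact h1

end Marks

/-! ### Averaging over all marks, and the limit R_b → ∞, for fixed station locations. -/

section Pointwise

variable {Ω : Type*} {N : ℕ} {c : Params} {α row : Fin N → ℝ}
  {X : ℕ → Ω → EuclideanSpace ℝ (Fin 2)}

lemma lintegral_marks (hpow : 0 < c.power) (hx : 0 < sinrThreshold c) (hα : ∀ j, 0 ≤ α j)
    (hsum : ∑ j, α j = 1) (Rb noise : ℝ) {ω : Ω} (hR : 0 < servingDistance X ω) :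
    ∫⁻ m, expNeg (ENNReal.ofReal (successFactor c (servingDistance X ω)) *
      (cachedInterference c X row Rb ω m + uncachedInterference c X row ω m +
        ENNReal.ofReal noise))
      ∂(Measure.infinitePi fun _ : ℕ => (transmitLaw α).prod (expMeasure 1)) =
    expNeg (∑' k, negLog (ENNReal.ofReal
      (interfererFactor c α row Rb (servingDistance X ω) ‖X k ω‖))) *
      expNeg (ENNReal.ofReal (successFactor c (servingDistance X ω)) * ENNReal.ofReal noise) := by
  classical
  have := isProbabilityMeasure_expMeasure one_pos
  have := isProbabilityMeasure_transmitLaw hα hsum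
  simp_rw [mul_add _ _ (ENNReal.ofReal noise), expNeg_add _ (_ * ENNReal.ofReal noise),
    interference_eq, ← ENNReal.tsum_mul_left]
  rw [lintegral_mul_const' _ _ (expNeg_ne_top _)]
  congr 1
  have hm : ∀ k : ℕ, Measurable fun y : Fin N × ℝ =>
      ENNReal.ofReal (successFactor c (servingDistance X ω)) *
      (if Interferes row Rb (servingDistance X ω) ‖X k ω‖ y.1 then
        ENNReal.ofReal (c.power * y.2 * ‖X k ω‖ ^ (-c.pathLoss)) else 0) := fun k =>
    Measurable.const_mul (Measurable.ite
      (measurableSet_interferes row Rb measurable_const measurable_const measurable_fst)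
      (by fun_prop) measurable_const) _
  rw [lintegral_infinitePi_expNeg_tsum _ hm]
  simp_rw [lintegral_mark hpow hx hα hR]

lemma iInf_area {b : ℝ} (hb : 0 < b) (ω : Ω) :
    ⨅ k, b * Real.pi * ‖X k ω‖ ^ 2 = b * Real.pi * servingDistance X ω ^ 2 := by
  have hbp : 0 < b * Real.pi := mul_pos hb Real.pi_pos
  have hbdd : BddBelow (Set.range fun k => b * Real.pi * ‖X k ω‖ ^ 2) :=
    ⟨0, by rintro _ ⟨k, rfl⟩; positivity⟩
  have hbdd' : BddBelow (Set.range fun k => ‖X k ω‖) :=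
    ⟨0, by rintro _ ⟨k, rfl⟩; positivity⟩
  have hR0 : 0 ≤ servingDistance X ω := Real.iInf_nonneg fun k => norm_nonneg _
  refine le_antisymm ?_ (le_ciInf fun k => ?_)
  · rw [← div_le_iff₀' hbp]
    refine (Real.sqrt_le_left hR0).1 (le_ciInf fun k => ?_)
    rw [Real.sqrt_le_left (norm_nonneg _), div_le_iff₀' hbp]
    exact ciInf_le hbdd k
  · have := ciInf_le hbdd' k
    have h2 : servingDistance X ω ^ 2 ≤ ‖X k ω‖ ^ 2 := pow_le_pow_left₀ hR0 this 2
    gcongr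

lemma ratio_rpow {b R d β : ℝ} (hb : 0 < b) (hR : 0 < R) (hd : 0 < d) :
    (b * Real.pi * d ^ 2 / (b * Real.pi * R ^ 2)) ^ (-(β / 2)) = (R / d) ^ β := by
  have hbp : b * Real.pi ≠ 0 := (mul_pos hb Real.pi_pos).ne'
  rw [mul_div_mul_left _ _ hbp, ← div_pow, Real.rpow_neg (by positivity), ← Real.inv_rpow
    (by positivity), ← inv_pow, inv_div, ← Real.rpow_natCast, ← Real.rpow_mul (by positivity)]
  congr 1
  push_cast; ring

/-- Each term is constant in `Rb` once `Rb` exceeds the distance of the station, so only domination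
of the sum is at stake. -/
lemma tendsto_tsum_negLog_interfererFactor (hb : 0 < c.bsDensity) (hx : 0 < sinrThreshold c)
    (hβ : 2 < c.pathLoss) (hα : ∀ j, 0 ≤ α j) (hsum : ∑ j, α j = 1)
    (hrow : ∀ j, row j = 0 ∨ row j = 1) {ω : Ω} (hR : 0 < servingDistance X ω)
    (hfin : ∑' k, ENNReal.ofReal
      ((1 + ‖c.bsDensity * Real.pi * ‖X k ω‖ ^ 2‖) ^ (-(c.pathLoss / 2))) < ∞) :
    Tendsto (fun Rb => ∑' k, negLog (ENNReal.ofReal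
        (interfererFactor c α row Rb (servingDistance X ω) ‖X k ω‖))) atTop
      (𝓝 (ratioSum
        (interferenceLog (uncachedProbability α row) (sinrThreshold c) (c.pathLoss / 2))
        (⨅ k, c.bsDensity * Real.pi * ‖X k ω‖ ^ 2)
        fun k => c.bsDensity * Real.pi * ‖X k ω‖ ^ 2)) := by
  rw [iInf_area hb]
  set R := servingDistance X ω
  have hbp : 0 < c.bsDensity * Real.pi := mul_pos hb Real.pi_pos
  have hlt : ∀ k, c.bsDensity * Real.pi * R ^ 2 < c.bsDensity * Real.pi * ‖X k ω‖ ^ 2 ↔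
      R < ‖X k ω‖ := fun k => by
    rw [mul_lt_mul_iff_right₀ hbp, pow_lt_pow_iff_left₀ hR.le (norm_nonneg _) two_ne_zero]
  simp only [ratioSum, ← lintegral_count]
  let m : ℝ := c.bsDensity * Real.pi * R ^ 2
  have hm : 0 < m := by positivity
  let D : ℝ := sinrThreshold c * m ^ (c.pathLoss / 2) * (1 + m⁻¹) ^ (c.pathLoss / 2)
  refine tendsto_lintegral_filter_of_dominated_convergence
    (fun k => ENNReal.ofReal D * ENNReal.ofReal
      ((1 + ‖c.bsDensity * Real.pi * ‖X k ω‖ ^ 2‖) ^ (-(c.pathLoss / 2))))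
    (Eventually.of_forall fun _ => measurable_of_countable _)
    (Eventually.of_forall fun Rb => ae_of_all _ fun k => ?_) ?_ (ae_of_all _ fun k => ?_)
  · rcases le_or_gt ‖X k ω‖ R with hk | hk
    · rw [interfererFactor_of_le hsum hk]
      simp [negLog]
    · have hk0 : 0 < ‖X k ω‖ := hR.trans hk
      refine (antitone_negLog (ENNReal.ofReal_le_ofReal
        (inv_le_interfererFactor hα hsum hx hR hk))).trans ((negLog_inv_le (by positivity)).trans ?_)
      rw [← ENNReal.ofReal_mul (by positivity)]
      refine ENNReal.ofReal_le_ofReal ?_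
      have h3 := rpow_neg_le_of_lt hm ((hlt k).2 hk) (γ := c.pathLoss / 2) (by linarith)
      rw [← ratio_rpow hb hR hk0, Real.div_rpow (by positivity) (by positivity),
        Real.rpow_neg (x := c.bsDensity * Real.pi * R ^ 2) (by positivity), div_inv_eq_mul]
      calc sinrThreshold c * ((c.bsDensity * Real.pi * ‖X k ω‖ ^ 2) ^ (-(c.pathLoss / 2)) *
            m ^ (c.pathLoss / 2))
          ≤ sinrThreshold c * ((1 + m⁻¹) ^ (c.pathLoss / 2) *
            (1 + ‖c.bsDensity * Real.pi * ‖X k ω‖ ^ 2‖) ^ (-(c.pathLoss / 2)) *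
            m ^ (c.pathLoss / 2)) := by gcongr
        _ = _ := by simp only [D]; ring
  · rw [lintegral_const_mul' _ _ ENNReal.ofReal_ne_top, lintegral_count]
    exact ENNReal.mul_ne_top ENNReal.ofReal_ne_top hfin.ne
  · refine tendsto_const_nhds.congr' ?_
    filter_upwards [eventually_ge_atTop ‖X k ω‖] with Rb hRb
    rcases le_or_gt ‖X k ω‖ R with hk | hk
    · rw [interfererFactor_of_le hsum hk, if_neg (by rw [hlt]; exact not_lt.2 hk)]
      simp [negLog]
    · rw [if_pos ((hlt k).2 hk), interfererFactor_of_le_cancel hsum hrow hk hRb, interferenceLog,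
        ratio_rpow hb hR (hR.trans hk)]

end Pointwise

/-! ### Averaging over the station locations. -/

section Limit

variable {Ω : Type*} [MeasurableSpace Ω] {μ : Measure Ω} [IsProbabilityMeasure μ] {N : ℕ}
  {c : Params} {α row : Fin N → ℝ} {X : ℕ → Ω → EuclideanSpace ℝ (Fin 2)}

/-- Fubini, integrating the serving gain first, then the marks, then the locations. Positive noise
keeps the denominator of the SINR nonzero. -/
lemma uncachedPLR_eq (hX : ∀ k, Measurable (X k)) (hR : ∀ᵐ ω ∂μ, 0 < servingDistance X ω)
    (hpow : 0 < c.power) (hB : 0 < c.bandwidth) (hτ : 0 < c.slot) (hT : 0 < c.packetSize)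
    (hα : ∀ j, 0 ≤ α j) (hsum : ∑ j, α j = 1) (Rb : ℝ) {noise : ℝ} (hnoise : 0 < noise) :
    uncachedPLR c μ X α row Rb noise = 1 - (∫⁻ ω, expNeg (∑' k, negLog (ENNReal.ofReal
      (interfererFactor c α row Rb (servingDistance X ω) ‖X k ω‖))) *
      expNeg (ENNReal.ofReal (successFactor c (servingDistance X ω)) *
        ENNReal.ofReal noise) ∂μ).toReal := by
  have := isProbabilityMeasure_expMeasure one_pos
  have := isProbabilityMeasure_transmitLaw hα hsum
  let S : Set (Ω × (ℕ → Fin N × ℝ) × ℝ) := {w | c.slot * c.bandwidth *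
    Real.logb 2 (1 + (sinr c X row Rb noise w.1 w.2.1 w.2.2).toReal) < c.packetSize}
  have hS : MeasurableSet S := measurableSet_loss c row hX Rb noise
  have : IsProbabilityMeasure (networkLaw μ α) := by unfold networkLaw; infer_instance
  have h1 : uncachedPLR c μ X α row Rb noise = 1 - (networkLaw μ α Sᶜ).toReal := by
    have h2 : (networkLaw μ α).real Sᶜ = 1 - (networkLaw μ α).real S :=
      probReal_compl_eq_one_sub hS
    rw [← measureReal_def, h2, sub_sub_cancel]
    rfl
  rw [h1, networkLaw, Measure.prod_apply hS.compl]
  congr 2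
  refine lintegral_congr_ae ?_
  filter_upwards [hR] with ω hω
  rw [← lintegral_marks hpow (sinrThreshold_pos hB hτ hT) hα hsum Rb noise hω,
    Measure.prod_apply (measurable_prodMk_left hS.compl)]
  refine lintegral_congr fun m => ?_
  have hD : cachedInterference c X row Rb ω m + uncachedInterference c X row ω m +
      ENNReal.ofReal noise ≠ 0 := by
    simp [hnoise]
  rw [← expMeasure_success hpow hB hτ hT hω hD]
  congr 1

/-- The limiting packet loss rate of an uncached packet. -/
theorem tendsto_uncachedPLR (hb : 0 < c.bsDensity) (hpow : 0 < c.power) (hβ : 2 < c.pathLoss)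
    (hB : 0 < c.bandwidth) (hτ : 0 < c.slot) (hT : 0 < c.packetSize)
    (hX : IsPoissonPointProcess X (ENNReal.ofReal c.bsDensity • volume) μ)
    (hα : ∀ j, 0 ≤ α j) (hsum : ∑ j, α j = 1) (hrow : ∀ j, row j = 0 ∨ row j = 1) :
    Tendsto (fun s : ℝ × ℝ => uncachedPLR c μ X α row s.1 s.2) (atTop ×ˢ 𝓝[>] 0)
      (𝓝 (1 - (1 + uncachedProbability α row * Z₁ c (sinrThreshold c))⁻¹)) := by
  have hx := sinrThreshold_pos hB hτ hT
  set a := uncachedProbability α row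
  have ha0 : 0 ≤ a := uncachedProbability_nonneg hα hsum hrow
  have ha1 : a ≤ 1 := uncachedProbability_le_one hα hrow
  have hγ : 1 < c.pathLoss / 2 := by linarith
  have hκ : 0 ≤ a * Z₁ c (sinrThreshold c) := mul_nonneg ha0 (Z₁_pos hβ hx).le
  have hV : IsPoissonPointProcess (fun k ω => c.bsDensity * Real.pi * ‖X k ω‖ ^ 2)
      (volume.restrict (Set.Ici 0)) μ := by
    rw [← map_area_volume hb]
    exact hX.map (g := fun x => c.bsDensity * Real.pi * ‖x‖ ^ 2) (by fun_prop)
  have hV0 : ∀ k ω, 0 ≤ c.bsDensity * Real.pi * ‖X k ω‖ ^ 2 := fun k ω => by positivity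
  have hR0 : ∀ ω, 0 ≤ servingDistance X ω := fun ω => Real.iInf_nonneg fun k => norm_nonneg _
  have hR : ∀ᵐ ω ∂μ, 0 < servingDistance X ω := by
    filter_upwards [ae_pos_iInf hV hV0] with ω hω
    rw [iInf_area hb] at hω
    refine lt_of_le_of_ne (hR0 ω) fun h => ?_
    simp [← h] at hω
  have hmain := lintegral_expNeg_ratioSum hV hV0 measurable_interferenceLog
    (continuousOn_interferenceLog ha1 hx.le) hγ hx.le
    (fun u hu => interferenceLog_le ha1 hx.le hu) hκ (by
      rw [lintegral_one_sub_expNeg_interferenceLog ha0 ha1 hx.le hγ, Z₁_eq_integral hβ])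
  have hlim : Tendsto (fun s : ℝ × ℝ => ∫⁻ ω, expNeg (∑' k, negLog (ENNReal.ofReal
      (interfererFactor c α row s.1 (servingDistance X ω) ‖X k ω‖))) *
      expNeg (ENNReal.ofReal (successFactor c (servingDistance X ω)) *
        ENNReal.ofReal s.2) ∂μ) (atTop ×ˢ 𝓝[>] 0)
      (𝓝 (ENNReal.ofReal (1 + a * Z₁ c (sinrThreshold c))⁻¹)) := by
    rw [← hmain]
    refine tendsto_lintegral_filter_of_dominated_convergence (fun _ => 1)
      (Eventually.of_forall fun s => ?_) (Eventually.of_forall fun s => ae_of_all _ fun ω =>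
        mul_le_one' (expNeg_le_one _) (expNeg_le_one _)) (by simp) ?_
    · have hmR := measurable_servingDistance hX.measurable
      refine Measurable.mul (measurable_expNeg.comp (Measurable.tsum fun k => ?_))
        (measurable_expNeg.comp (Measurable.mul_const ?_ _))
      · refine measurable_negLog.comp (Measurable.ennreal_ofReal ?_)
        have hk := hX.measurable k
        unfold interfererFactor
        refine Finset.measurable_sum _ fun j _ => Measurable.const_mul (Measurable.ite
          (measurableSet_interferes row s.1 hmR hk.norm measurable_const) ?_ measurable_const) _
        fun_prop
      · unfold successFactor
        fun_prop
    · filter_upwards [hR, ae_tsum_rpow_lt_top hV hγ] with ω hω hω'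
      have h1 := (continuous_expNeg.tendsto _).comp
        (tendsto_tsum_negLog_interfererFactor (row := row) hb hx hβ hα hsum hrow hω hω')
      have h2 : Tendsto (fun noise : ℝ => expNeg (ENNReal.ofReal
          (successFactor c (servingDistance X ω)) * ENNReal.ofReal noise)) (𝓝[>] 0) (𝓝 1) := by
        have hc : Continuous fun noise : ℝ => expNeg (ENNReal.ofReal
            (successFactor c (servingDistance X ω)) * ENNReal.ofReal noise) :=
          continuous_expNeg.comp ((ENNReal.continuous_const_mul ENNReal.ofReal_ne_top).comp
            ENNReal.continuous_ofReal)
        simpa using (hc.tendsto 0).mono_left nhdsWithin_le_nhds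
      have h3 := ENNReal.Tendsto.mul (h1.comp (tendsto_fst (g := 𝓝[>] (0 : ℝ))))
        (Or.inr (by simp)) (h2.comp (tendsto_snd (f := (atTop : Filter ℝ))))
        (Or.inr (expNeg_ne_top _))
      simpa using h3
  have h4 := ((ENNReal.tendsto_toReal ENNReal.ofReal_ne_top).comp hlim).const_sub 1
  rw [ENNReal.toReal_ofReal (by positivity)] at h4
  refine h4.congr' ?_
  filter_upwards [tendsto_snd.eventually (self_mem_nhdsWithin (a := (0 : ℝ)))] with s hs
  exact (uncachedPLR_eq hX.measurable hR hpow hB hτ hT hα hsum s.1 hs).symm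

end Limit

/-! ### The limiting average packet loss rate -/

/-- Every packet is uncached with the same probability 1 - M/N, nonzero as M < N, so this factor
cancels from the quotient. -/
lemma transmitFraction_eq {N M : ℕ} (hMN : M < N) {f : Fin N → ℝ} (hfsum : ∑ j, f j = 1)
    {p : Fin (N.choose M) → ℝ} {q : Fin (N.choose M) → Fin N → ℝ} (hp : ∑ i, p i = 1)
    (hq : ∀ j, cachingProbability p q j = (M : ℝ) / N) : transmitFraction f p q = f := by
  have h1 : ∀ j, ∑ i, p i * (1 - q i j) * f j = (1 - (M : ℝ) / N) * f j := fun j => by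
    rw [← Finset.sum_mul, ← hq j, cachingProbability]
    simp only [mul_sub, mul_one, Finset.sum_sub_distrib, hp]
  have hN : (0 : ℝ) < N := by exact_mod_cast (Nat.zero_le M).trans_lt hMN
  have h2 : 1 - (M : ℝ) / N ≠ 0 := by
    have : (M : ℝ) / N < 1 := by rw [div_lt_one hN]; exact_mod_cast hMN
    linarith
  funext j
  simp_rw [transmitFraction, h1]
  rw [← Finset.mul_sum, hfsum, mul_one, mul_div_cancel_left₀ _ h2]

/-- The contribution of a cache to the objective of the program. -/
def rowObjective (c : Params) {N : ℕ} (f row : Fin N → ℝ) : ℝ :=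
  (1 - ∑ j, row j * f j) / (1 + (1 - ∑ j, f j * row j)⁻¹ * (Z₁ c (sinrThreshold c))⁻¹)

/-- At a = 0 both sides are 0, the numerator being 0 as in the convention of the program. -/
lemma rowObjective_eq {c : Params} (hZ : 0 < Z₁ c (sinrThreshold c)) {N : ℕ} {f row : Fin N → ℝ}
    (ha : 0 ≤ uncachedProbability f row) :
    (1 - (1 + uncachedProbability f row * Z₁ c (sinrThreshold c))⁻¹) * uncachedProbability f row =
      rowObjective c f row := by
  have h1 : ∑ j, f j * row j = ∑ j, row j * f j := Finset.sum_congr rfl fun j _ => mul_comm _ _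
  rw [rowObjective, h1]
  change _ = uncachedProbability f row / (1 + (uncachedProbability f row)⁻¹ * _)
  generalize uncachedProbability f row = a at *
  rcases ha.eq_or_lt with rfl | ha
  · simp
  · field_simp
    ring

theorem hasLimitingPLR {N M : ℕ} (hMN : M < N)
    {c : Params} (hdens : 0 < c.bsDensity) (hpow : 0 < c.power) (hβ : 2 < c.pathLoss)
    (hB : 0 < c.bandwidth) (hτ : 0 < c.slot) (hT : 0 < c.packetSize)
    {f : Fin N → ℝ} (hf : ∀ j, 0 ≤ f j) (hfsum : ∑ j, f j = 1)
    {Ω : Type*} [MeasurableSpace Ω] {μ : Measure Ω} [IsProbabilityMeasure μ]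
    {X : ℕ → Ω → EuclideanSpace ℝ (Fin 2)}
    (hX : IsPoissonPointProcess X (ENNReal.ofReal c.bsDensity • volume) μ)
    {p : Fin (N.choose M) → ℝ} {q : Fin (N.choose M) → Fin N → ℝ} (hpq : IsCachingScheme M p q)
    (hq : ∀ j, cachingProbability p q j = (M : ℝ) / N) :
    HasLimitingPLR c μ X f p q (objective c f p q) := by
  have havg : ∀ s : ℝ × ℝ, averagePLR c μ X f p q s.1 s.2 =
      ∑ i, p i * (uncachedPLR c μ X f (q i) s.1 s.2 * uncachedProbability f (q i)) := fun s => by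
    simp only [averagePLR, packetLossRate, transmitFraction_eq hMN hfsum hpq.density_sum hq]
    refine Finset.sum_congr rfl fun i _ => ?_
    rw [uncachedProbability_eq hfsum]
    refine congrArg (p i * ·) ?_
    rw [Finset.mul_sum]
    exact Finset.sum_congr rfl fun j _ => by ring
  simp only [HasLimitingPLR, havg]
  refine tendsto_finsetSum _ fun i _ => Tendsto.const_mul (p i) ?_
  have h := (tendsto_uncachedPLR hdens hpow hβ hB hτ hT hX hf hfsum (hpq.binary i)).mul_const
    (uncachedProbability f (q i))
  rwa [rowObjective_eq (Z₁_pos hβ (sinrThreshold_pos hB hτ hT))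
    (uncachedProbability_nonneg hf hfsum (hpq.binary i))] at h

/-! ### The optimization problem -/

lemma IsFeasible.isCachingScheme {N M : ℕ} {p : Fin (N.choose M) → ℝ}
    {q : Fin (N.choose M) → Fin N → ℝ} (h : IsFeasible M p q) : IsCachingScheme M p q :=
  ⟨h.binary, h.density_mem, h.cache_size, h.density_sum⟩

lemma IsFeasible.cachingProbability_eq {N M : ℕ} {p : Fin (N.choose M) → ℝ}
    {q : Fin (N.choose M) → Fin N → ℝ} (h : IsFeasible M p q) (j : Fin N) :
    cachingProbability p q j = (M : ℝ) / N := by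
  rw [← h.caching_probability j]
  exact Finset.sum_congr rfl fun i _ => mul_comm _ _

/-- Permuting the subsets of a scheme makes it feasible. -/
lemma IsCachingScheme.exists_perm_isFeasible {N M : ℕ} {p : Fin (N.choose M) → ℝ}
    {q : Fin (N.choose M) → Fin N → ℝ} (h : IsCachingScheme M p q)
    (hq : ∀ j, cachingProbability p q j = (M : ℝ) / N) :
    ∃ σ : Equiv.Perm (Fin (N.choose M)), IsFeasible M (p ∘ σ) (q ∘ σ) := by
  refine ⟨Tuple.sort fun i => -p i, fun i => h.binary _, fun i => h.density_mem _,
    fun i => h.cache_size _, ?_, fun j => ?_, fun i j hij => ?_⟩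
  · rw [← h.density_sum]
    exact Equiv.sum_comp _ p
  · rw [← hq j, cachingProbability,
      ← Equiv.sum_comp (Tuple.sort fun i => -p i) fun i => p i * q i j]
    exact Finset.sum_congr rfl fun i _ => mul_comm _ _
  · exact neg_le_neg_iff.1 (Tuple.monotone_sort (fun i => -p i) hij.le)

lemma objective_comp_perm (c : Params) {N M : ℕ} (f : Fin N → ℝ) (p : Fin (N.choose M) → ℝ)
    (q : Fin (N.choose M) → Fin N → ℝ) (σ : Equiv.Perm (Fin (N.choose M))) :
    objective c f (p ∘ σ) (q ∘ σ) = objective c f p q :=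
  Equiv.sum_comp σ fun i => p i * rowObjective c f (q i)

/-- An enumeration of the caches. -/
def cacheEquiv (N M : ℕ) : Fin (N.choose M) ≃ {s : Finset (Fin N) // s.card = M} :=
  (Fintype.equivFinOfCardEq (by simp)).symm

/-- The scheme matrix that lists every cache once. -/
def allCaches (N M : ℕ) (i : Fin (N.choose M)) (j : Fin N) : ℝ :=
  if j ∈ (cacheEquiv N M i).1 then 1 else 0

lemma allCaches_binary {N M : ℕ} (i : Fin (N.choose M)) (j : Fin N) :
    allCaches N M i j = 0 ∨ allCaches N M i j = 1 := by
  unfold allCaches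
  split_ifs <;> simp

lemma sum_allCaches {N M : ℕ} (i : Fin (N.choose M)) : ∑ j, allCaches N M i j = M := by
  simp [allCaches, (cacheEquiv N M i).2]

lemma exists_allCaches_eq {N M : ℕ} {row : Fin N → ℝ} (hrow : ∀ j, row j = 0 ∨ row j = 1)
    (hsum : ∑ j, row j = M) : ∃ i, row = allCaches N M i := by
  classical
  have h1 : ∀ j, row j = if row j = 1 then 1 else 0 := fun j => by
    rcases hrow j with h | h <;> simp [h]
  have hcard : (Finset.univ.filter fun j => row j = 1).card = M := by
    rw [Finset.sum_congr rfl fun j _ => h1 j, Finset.sum_boole] at hsum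
    exact_mod_cast hsum
  refine ⟨(cacheEquiv N M).symm ⟨_, hcard⟩, ?_⟩
  funext j
  rw [allCaches, Equiv.apply_symm_apply, h1 j]
  simp

lemma allCaches_injective (N M : ℕ) : Function.Injective (allCaches N M) := by
  intro i i' h
  refine (cacheEquiv N M).injective (Subtype.ext (Finset.ext fun j => ?_))
  have := congrFun h j
  unfold allCaches at this
  by_cases h1 : j ∈ (cacheEquiv N M i).1 <;> by_cases h2 : j ∈ (cacheEquiv N M i').1 <;>
    simp [h1, h2] at this ⊢

/-- Swapping the packets j and j' permutes the caches. -/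
lemma sum_allCaches_comm {N M : ℕ} (j j' : Fin N) :
    ∑ i, allCaches N M i j = ∑ i, allCaches N M i j' := by
  classical
  let g : {s : Finset (Fin N) // s.card = M} ≃ {s : Finset (Fin N) // s.card = M} :=
    (Equiv.swap j j').finsetCongr.subtypeEquiv fun s => by simp
  rw [← Equiv.sum_comp (((cacheEquiv N M).trans g).trans (cacheEquiv N M).symm)]
  refine Finset.sum_congr rfl fun i _ => ?_
  simp only [allCaches, Equiv.trans_apply, Equiv.apply_symm_apply]
  have : j ∈ (g (cacheEquiv N M i)).1 ↔ j' ∈ (cacheEquiv N M i).1 := by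
    simp [g, Equiv.subtypeEquiv, Equiv.swap_apply_left]
  simp [this]

/-- Double counting of pairs (cache, packet in it), given the symmetry between packets. -/
lemma sum_allCaches_div {N M : ℕ} (hMN : M < N) (j : Fin N) :
    ∑ i, allCaches N M i j * ((N.choose M : ℝ))⁻¹ = (M : ℝ) / N := by
  have hN : (N : ℝ) ≠ 0 := by
    have := (Nat.zero_le M).trans_lt hMN
    positivity
  have hC : (N.choose M : ℝ) ≠ 0 := by exact_mod_cast (Nat.choose_pos hMN.le).ne'
  have h1 : (N : ℝ) * ∑ i, allCaches N M i j = N.choose M * M := by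
    calc (N : ℝ) * ∑ i, allCaches N M i j = ∑ j', ∑ i, allCaches N M i j' := by
          rw [Finset.sum_congr rfl fun j' _ => sum_allCaches_comm j' j]
          simp
      _ = N.choose M * M := by
          rw [Finset.sum_comm, Finset.sum_congr rfl fun i _ => sum_allCaches i]
          simp
  rw [← Finset.sum_mul]
  field_simp
  linarith

/-- Merging the subsets with equal caches. -/
lemma IsCachingScheme.exists_merge {N M : ℕ} {p : Fin (N.choose M) → ℝ}
    {q : Fin (N.choose M) → Fin N → ℝ} (h : IsCachingScheme M p q) :
    ∃ w : Fin (N.choose M) → ℝ, (∀ i, 0 ≤ w i) ∧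
      ∀ G : (Fin N → ℝ) → ℝ, ∑ i, w i * G (allCaches N M i) = ∑ i, p i * G (q i) := by
  classical
  choose π hπ using fun i => exists_allCaches_eq (h.binary i) (h.cache_size i)
  refine ⟨fun k => ∑ i with π i = k, p i, fun k => Finset.sum_nonneg fun i _ =>
    (h.density_mem i).1, fun G => ?_⟩
  rw [← Finset.sum_fiberwise Finset.univ π fun i => p i * G (q i)]
  refine Finset.sum_congr rfl fun k _ => ?_
  rw [Finset.sum_mul]
  refine Finset.sum_congr rfl fun i hi => ?_
  rw [hπ i, (Finset.mem_filter.1 hi).2]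

/-- The distributions over all caches with uniform caching probabilities. -/
def uniformWeights (N M : ℕ) : Set (Fin (N.choose M) → ℝ) :=
  {w | (∀ i, 0 ≤ w i) ∧ ∑ i, w i = 1 ∧ ∀ j, ∑ i, w i * allCaches N M i j = (M : ℝ) / N}

lemma mem_uniformWeights_le_one {N M : ℕ} {w : Fin (N.choose M) → ℝ}
    (hw : w ∈ uniformWeights N M) (i : Fin (N.choose M)) : w i ≤ 1 := by
  rw [← hw.2.1]
  exact Finset.single_le_sum (fun i _ => hw.1 i) (Finset.mem_univ i)

lemma isCompact_uniformWeights (N M : ℕ) : IsCompact (uniformWeights N M) := by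
  refine (isCompact_Icc (a := (0 : Fin (N.choose M) → ℝ)) (b := 1)).of_isClosed_subset ?_
    fun w hw => ⟨hw.1, mem_uniformWeights_le_one hw⟩
  have h1 : IsClosed {w : Fin (N.choose M) → ℝ | ∀ i, 0 ≤ w i} := by
    simp only [Set.ofPred_forall]
    exact isClosed_iInter fun i => isClosed_le continuous_const (continuous_apply i)
  have h2 : IsClosed {w : Fin (N.choose M) → ℝ | ∑ i, w i = 1} :=
    isClosed_eq (by fun_prop) continuous_const
  have h3 : IsClosed {w : Fin (N.choose M) → ℝ |
      ∀ j, ∑ i, w i * allCaches N M i j = (M : ℝ) / N} := by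
    simp only [Set.ofPred_forall]
    exact isClosed_iInter fun j => isClosed_eq (by fun_prop) continuous_const
  exact h1.inter (h2.inter h3)

lemma uniformWeights_nonempty {N M : ℕ} (hMN : M < N) : (uniformWeights N M).Nonempty := by
  have hC : (N.choose M : ℝ) ≠ 0 := by exact_mod_cast (Nat.choose_pos hMN.le).ne'
  refine ⟨fun _ => (N.choose M : ℝ)⁻¹, fun _ => by positivity, by simp [hC], fun j => ?_⟩
  rw [← sum_allCaches_div hMN j]
  exact Finset.sum_congr rfl fun i _ => mul_comm _ _

/-- Merging preserves the sum of p_i G(q_i) for every G; it is used with G = 1, with the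
coordinates, and with `rowObjective`. -/
lemma IsCachingScheme.exists_uniformWeights (c : Params) {N M : ℕ} (f : Fin N → ℝ)
    {p : Fin (N.choose M) → ℝ} {q : Fin (N.choose M) → Fin N → ℝ} (h : IsCachingScheme M p q)
    (hq : ∀ j, cachingProbability p q j = (M : ℝ) / N) :
    ∃ w ∈ uniformWeights N M, objective c f w (allCaches N M) = objective c f p q := by
  obtain ⟨w, hw0, hw⟩ := h.exists_merge
  refine ⟨w, ⟨hw0, ?_, fun j => ?_⟩, hw (rowObjective c f)⟩
  · simpa [h.density_sum] using hw fun _ => 1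
  · rw [← hq j]
    exact hw fun row => row j

lemma isCachingScheme_allCaches {N M : ℕ} {w : Fin (N.choose M) → ℝ}
    (hw : w ∈ uniformWeights N M) : IsCachingScheme M w (allCaches N M) :=
  ⟨allCaches_binary, fun i => ⟨hw.1 i, mem_uniformWeights_le_one hw i⟩, sum_allCaches, hw.2.1⟩

/-- The program has an optimal solution with distinct caches. -/
theorem exists_isOptimal_injective (c : Params) {N M : ℕ} (hMN : M < N) (f : Fin N → ℝ) :
    ∃ (p : Fin (N.choose M) → ℝ) (q : Fin (N.choose M) → Fin N → ℝ),
      IsOptimal c f p q ∧ Function.Injective q := by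
  -- With the matrix fixed, the objective is linear in the weights.
  have hcont : ContinuousOn (fun w : Fin (N.choose M) → ℝ => objective c f w (allCaches N M))
      (uniformWeights N M) := by
    unfold objective
    fun_prop
  obtain ⟨w, hw, hmin⟩ := (isCompact_uniformWeights N M).exists_isMinOn
    (uniformWeights_nonempty hMN) hcont
  obtain ⟨σ, hσ⟩ := (isCachingScheme_allCaches hw).exists_perm_isFeasible hw.2.2
  refine ⟨_, _, ⟨hσ, fun p' q' h' => ?_⟩, (allCaches_injective N M).comp σ.injective⟩
  obtain ⟨w', hw', heq⟩ :=
    h'.isCachingScheme.exists_uniformWeights c f h'.cachingProbability_eq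
  rw [objective_comp_perm, ← heq]
  exact hmin hw'

end CacheNetwork

end

/-! ### Assembly of the proposition. -/

open CacheNetwork in
theorem proposition2 {N M : ℕ} (hMN : M < N)
    (c : Params) (hdens : 0 < c.bsDensity) (hpow : 0 < c.power) (hβ : 2 < c.pathLoss)
    (hB : 0 < c.bandwidth) (hτ : 0 < c.slot) (hT : 0 < c.packetSize)
    (f : Fin N → ℝ) (hf : ∀ j, 0 ≤ f j) (hfsum : ∑ j, f j = 1)
    {Ω : Type*} [MeasurableSpace Ω] (μ : Measure Ω) [IsProbabilityMeasure μ]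
    (X : ℕ → Ω → EuclideanSpace ℝ (Fin 2))
    (hX : IsPoissonPointProcess X (ENNReal.ofReal c.bsDensity • volume) μ) :
    -- the limiting average packet loss rate of every scheme with `q_j = M / N`
    (∀ (p : Fin (N.choose M) → ℝ) (q : Fin (N.choose M) → Fin N → ℝ), IsCachingScheme M p q →
      (∀ j, cachingProbability p q j = (M : ℝ) / N) →
        HasLimitingPLR c μ X f p q (objective c f p q)) ∧
    -- the program has an optimal solution whose rows are the distinct caches
    (∃ (p : Fin (N.choose M) → ℝ) (q : Fin (N.choose M) → Fin N → ℝ),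
      IsOptimal c f p q ∧ Function.Injective q) ∧
    -- every optimal solution attains the minimum achievable average packet loss rate
    (∀ (p : Fin (N.choose M) → ℝ) (q : Fin (N.choose M) → Fin N → ℝ), IsOptimal c f p q →
      HasLimitingPLR c μ X f p q (objective c f p q) ∧
      IsLeast {L : ℝ | ∃ (p' : Fin (N.choose M) → ℝ) (q' : Fin (N.choose M) → Fin N → ℝ),
        IsCachingScheme M p' q' ∧ Function.Injective q' ∧
        (∀ j, cachingProbability p' q' j = (M : ℝ) / N) ∧ HasLimitingPLR c μ X f p' q' L}
        (objective c f p q)) := by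
  have hlim : ∀ (p : Fin (N.choose M) → ℝ) (q : Fin (N.choose M) → Fin N → ℝ),
      IsCachingScheme M p q → (∀ j, cachingProbability p q j = (M : ℝ) / N) →
        HasLimitingPLR c μ X f p q (objective c f p q) := fun p q hpq hq =>
    hasLimitingPLR hMN hdens hpow hβ hB hτ hT hf hfsum hX hpq hq
  refine ⟨hlim, exists_isOptimal_injective c hMN f, fun p q hopt => ?_⟩
  refine ⟨hlim p q hopt.1.isCachingScheme hopt.1.cachingProbability_eq, ?_, ?_⟩
  -- The given optimum may repeat a cache, so membership is witnessed by an optimum with distinct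
  -- caches, which has the same value.
  · obtain ⟨p₀, q₀, hopt₀, hinj⟩ := exists_isOptimal_injective c hMN f
    have heq : objective c f p q = objective c f p₀ q₀ :=
      le_antisymm (hopt.2 _ _ hopt₀.1) (hopt₀.2 _ _ hopt.1)
    refine ⟨p₀, q₀, hopt₀.1.isCachingScheme, hinj, hopt₀.1.cachingProbability_eq, ?_⟩
    rw [heq]
    exact hlim _ _ hopt₀.1.isCachingScheme hopt₀.1.cachingProbability_eq
  · rintro L ⟨p', q', hpq, -, hq, hL⟩
    -- By uniqueness of limits, L is the objective of the competitor, and sorting its subsets makes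
    -- it feasible.
    rw [tendsto_nhds_unique hL (hlim p' q' hpq hq)]
    obtain ⟨σ, hσ⟩ := hpq.exists_perm_isFeasible hq
    rw [← objective_comp_perm c f p' q' σ]
    exact hopt.2 _ _ hσ
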